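/- Let $q$ be a power of $2$, and let $D=\{(x:y:0)\mid x,y\in \mathrm{GF}(q),\ (x,y)\neq(0,0)\}$ be the standard derivation set on the line at infinity $\ell_\infty: Z=0$ of $\mathrm{PG}(2,q^2)$. The points of the affine Hall plane $\mathrm{Hall}(q^2)$ are the pairs $(x,y)\in \mathrm{GF}(q^2)^2$, identified with $(x:y:1)$; its lines are the old lines $Y=mX+b$ with $m\in \mathrm{GF}(q^2)\setminus \mathrm{GF}(q)$, $b\in\mathrm{GF}(q^2)$, and the new lines $\{(a+\lambda u,\,b+\lambda v)\mid u,v\in \mathrm{GF}(q)\}$ with $a,b,\lambda\in \mathrm{GF}(q^2)$, $\lambda\ne 0$. Let $K$ be a conic of $\mathrm{PG}(2,q^2)$, that is, the set of zeros of a ternary quadratic form over $\mathrm{GF}(q^2)$ that is irreducible over the algebraic closure. Call $K$ an ellipse if it has no point on $\ell_\infty$, and a hyperbola if it has exactly two points on $\ell_\infty$. The conjugate of the point $(x:y:0)$ is $(x^q:y^q:0)$. A collinear triple is a set of three distinct points of the affine part $K\setminus\ell_\infty$ of $K$ that lie on a common line of $\mathrm{Hall}(q^2)$. Then the following hold. (a)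 If $K$ is an ellipse, or a hyperbola whose two points on $\ell_\infty$ lie outside $D$ and are not conjugate to each other, then every line of $\mathrm{Hall}(q^2)$ meets the affine part of $K$ in at most $4$ points, and the number of collinear triples is $\binom{q+1}{3}$. (b) If $K$ is a hyperbola with exactly one point in $D$, then every line of $\mathrm{Hall}(q^2)$ meets the affine part of $K$ in at most $3$ points, and the number of collinear triples is $\binom{q}{3}$. -/

import Mathlib

namespace HallPlane

/-- The points of the Desarguesian projective plane over `F`. -/
abbrev PG2 (F : Type*) [Field F] : Type _ := Projectivization F (Fin 3 → F)

/-- The line at infinity, with equation `Z = 0`. -/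
def lineAtInfinity (F : Type*) [Field F] : Set (PG2 F) :=
  {P | P.rep 2 = 0}

/-- The standard derivation set `{(x : y : 0) | x, y ∈ k}` on the line at infinity. -/
def derivationSet {F : Type*} [Field F] (k : Subfield F) : Set (PG2 F) :=
  {P | ∃ (x y : F) (h : ![x, y, 0] ≠ 0), x ∈ k ∧ y ∈ k ∧ P = Projectivization.mk F ![x, y, 0] h}

/-- `P'` is obtained from `P` by raising homogeneous coordinates to the power `q`. -/
def Conjugate {F : Type*} [Field F] (q : ℕ) (P P' : PG2 F) : Prop :=
  ∃ (v : Fin 3 → F) (h : v ≠ 0) (h' : (fun i => v i ^ q) ≠ 0),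
    P = Projectivization.mk F v h ∧ P' = Projectivization.mk F (fun i => v i ^ q) h'

/-- The affine point `(x, y)` as the point `(x : y : 1)` of the projective plane. -/
def affinePoint {F : Type*} [Field F] (p : F × F) : PG2 F :=
  Projectivization.mk F ![p.1, p.2, 1] (fun h => one_ne_zero (congrFun h 2))

/-- The affine part of a set of points of the projective plane. -/
def affinePart {F : Type*} [Field F] (K : Set (PG2 F)) : Set (F × F) :=
  {p | affinePoint p ∈ K}

/-- The quadratic form `a X² + b Y² + c Z² + d YZ + e XZ + f XY`. -/
noncomputable def quadForm {F : Type*} [Field F] (a b c d e f : F) : MvPolynomial (Fin 3) F :=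
  .C a * .X 0 ^ 2 + .C b * .X 1 ^ 2 + .C c * .X 2 ^ 2
    + .C d * (.X 1 * .X 2) + .C e * (.X 0 * .X 2) + .C f * (.X 0 * .X 1)

/-- The points of the projective plane at which a quadratic form vanishes. -/
def quadZeros {F : Type*} [Field F] (a b c d e f : F) : Set (PG2 F) :=
  {P | MvPolynomial.eval P.rep (quadForm a b c d e f) = 0}

/-- An irreducible conic: the point set given by a quadratic form that is (absolutely)
irreducible, that is, irreducible over the algebraic closure of `F`. -/
def IsConic {F : Type*} [Field F] (K : Set (PG2 F)) : Prop :=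
  ∃ a b c d e f : F,
    Irreducible ((quadForm a b c d e f).map (algebraMap F (AlgebraicClosure F))) ∧
      K = quadZeros a b c d e f

/-- An ellipse is a conic without points on the line at infinity. -/
def IsEllipse {F : Type*} [Field F] (K : Set (PG2 F)) : Prop :=
  IsConic K ∧ K ∩ lineAtInfinity F = ∅

/-- A hyperbola is a conic with two points on the line at infinity. -/
def IsHyperbola {F : Type*} [Field F] (K : Set (PG2 F)) : Prop :=
  IsConic K ∧ (K ∩ lineAtInfinity F).ncard = 2

/-- The old lines `Y = m X + b`, `m ∉ k`. -/
def oldLines {F : Type*} [Field F] (k : Subfield F) : Set (Set (F × F)) :=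
  {L | ∃ m b : F, m ∉ k ∧ L = {p | p.2 = m * p.1 + b}}

/-- The new lines `{(a + t u, b + t v) | u, v ∈ k}`, `t ≠ 0`. -/
def newLines {F : Type*} [Field F] (k : Subfield F) : Set (Set (F × F)) :=
  {L | ∃ a b t : F, t ≠ 0 ∧ L = {p | ∃ u ∈ k, ∃ v ∈ k, p = (a + t * u, b + t * v)}}

/-- The lines of the affine Hall plane on the point set `F × F`. -/
def hallLines {F : Type*} [Field F] (k : Subfield F) : Set (Set (F × F)) :=
  oldLines k ∪ newLines k

/-- The triples of distinct points of `A` that lie on a common line of the Hall plane. -/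
def collinearTriples {F : Type*} [Field F] (k : Subfield F) (A : Set (F × F)) :
    Set (Finset (F × F)) :=
  {T | T.card = 3 ∧ (T : Set (F × F)) ⊆ A ∧ ∃ L ∈ hallLines k, (T : Set (F × F)) ⊆ L}

/-- Vanishing of the quadratic form does not depend on the representative. -/
theorem mk_mem_quadZeros {F : Type*} [Field F] (a b c d e f : F) (v : Fin 3 → F) (hv : v ≠ 0) :
    Projectivization.mk F v hv ∈ quadZeros a b c d e f ↔
      a * v 0 ^ 2 + b * v 1 ^ 2 + c * v 2 ^ 2 + d * (v 1 * v 2) + e * (v 0 * v 2)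
        + f * (v 0 * v 1) = 0 := by
  obtain ⟨t, ht⟩ := Projectivization.exists_smul_eq_mk_rep F v hv
  have ht0 : (t : F) ≠ 0 := t.ne_zero
  have hr : ∀ i, (Projectivization.mk F v hv).rep i = (t : F) * v i := fun i => by
    rw [← ht]; rfl
  have key : MvPolynomial.eval (Projectivization.mk F v hv).rep (quadForm a b c d e f) =
      (t : F) ^ 2 * (a * v 0 ^ 2 + b * v 1 ^ 2 + c * v 2 ^ 2 + d * (v 1 * v 2)
        + e * (v 0 * v 2) + f * (v 0 * v 1)) := by
    simp only [quadForm, map_add, map_mul, map_pow, MvPolynomial.eval_C, MvPolynomial.eval_X, hr]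
    ring
  rw [quadZeros, Set.mem_setOf_eq, key]
  simp [ht0]

/-- Membership in the line at infinity does not depend on the representative. -/
theorem mk_mem_lineAtInfinity {F : Type*} [Field F] (v : Fin 3 → F) (hv : v ≠ 0) :
    Projectivization.mk F v hv ∈ lineAtInfinity F ↔ v 2 = 0 := by
  obtain ⟨t, ht⟩ := Projectivization.exists_smul_eq_mk_rep F v hv
  have hr : (Projectivization.mk F v hv).rep 2 = (t : F) * v 2 := by
    rw [← ht]; rfl
  rw [lineAtInfinity, Set.mem_setOf_eq, hr]
  simp [t.ne_zero]

end HallPlane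

namespace HallPlane

/-! A conic that is not tangent to `Z = 0` has a nonzero mixed coefficient `f` in characteristic
two, so a translation removes the linear terms. Its affine part is then `Q(p + p₀) = c`, where `Q`
is a binary quadratic form with polar form `f * det2`; absolute irreducibility gives `c ≠ 0`. The
points of `K` at infinity are the zeros of `Q`.

Counting. Three points on a new line are `P`, `P + t w₁`, `P + t w₂` with `w₁, w₂` over `k`. With `v
= P + p₀`, membership in the conic says `t Q(wᵢ) = f det2 v wᵢ`. Solving for `v` and applying `Q`
gives `c (f det2 w₁ w₂)² = t² Q(w₁) Q(w₂) Q(w₁ + w₂)` (`binForm_mul_sq`). Since squaring is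
bijective, a pair `(w₁, w₂)` determines `t` and `P`, and every independent pair with the three
values of `Q` nonzero occurs (`bijOn_scaledTriples`). Each ordered triple arises from `q - 1`
scales, and each set from 6 orders. If `Q` has no zero in `D`, the pairs number `|GL₂(q)|`; with one
zero in `D` they number `(q - 1)(q - 2) q (q - 1)`.

Bounds. Old lines are Desarguesian lines and contain at most two points. On a new line, a further
point `w₃ = x w₁ + y w₂` satisfies `Q(w₁) r + Q(w₂) s = f det2 w₁ w₂` with `r = (x + 1)/y` and `s =
(y + 1)/x` in `k`. If `Q` is not proportional to a form over `k`, this fixes `r` and `s`, hence `x`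
and `y`. A zero of `Q` in `D` forces `r s = 1`, which excludes a fourth point. Proportionality to a
form over `k` is impossible in every case considered, because such a form has zeros over the
quadratic extension, permuted by Frobenius. -/

/-- The binary quadratic form `a x² + f x y + b y²`. -/
def binForm {F : Type*} [Field F] (a b f : F) (w : F × F) : F :=
  a * w.1 ^ 2 + f * (w.1 * w.2) + b * w.2 ^ 2

/-- The symmetric (in characteristic two: alternating) determinant of two vectors. -/
def det2 {F : Type*} [Field F] (v w : F × F) : F := v.1 * w.2 + v.2 * w.1

/-- The affine conic `Q(p + p₀) = c`. -/
def centralConic {F : Type*} [Field F] (a b f : F) (p₀ : F × F) (c : F) : Set (F × F) :=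
  {p | binForm a b f (p + p₀) = c}

/-! ### Binary quadratic forms and chords in characteristic two -/

section Algebra

variable {F : Type*} [Field F] {a b f c : F} {p₀ : F × F}

theorem binForm_smul (s : F) (w : F × F) : binForm a b f (s • w) = s ^ 2 * binForm a b f w := by
  simp only [binForm, Prod.smul_fst, Prod.smul_snd, smul_eq_mul]; ring

theorem exists_smul_of_det2_eq_zero (h2 : (2 : F) = 0) {v w : F × F} (hv : v ≠ 0)
    (h : det2 v w = 0) : ∃ s : F, w = s • v := by
  obtain ⟨x, y⟩ := v
  obtain ⟨x', y'⟩ := w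
  simp only [det2] at h
  by_cases hx : x = 0
  · have hy : y ≠ 0 := by rintro rfl; exact hv (by simp [hx])
    subst hx
    refine ⟨y' / y, ?_⟩
    have : x' = 0 := by
      have : y * x' = 0 := by linear_combination h
      simpa [hy] using this
    ext <;> simp [this, hy]
  · refine ⟨x' / x, ?_⟩
    ext
    · simp [hx]
    · simp only [Prod.smul_mk, smul_eq_mul]
      field_simp
      linear_combination h - y * x' * h2

/-- An isotropic vector is not orthogonal to an anisotropic one. -/
theorem det2_ne_zero_of_binForm (h2 : (2 : F) = 0) {v w : F × F} (hw : w ≠ 0)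
    (hv : binForm a b f v ≠ 0) (hQ : binForm a b f w = 0) : det2 w v ≠ 0 := by
  intro h
  obtain ⟨s, rfl⟩ := exists_smul_of_det2_eq_zero h2 hw h
  exact hv (by rw [binForm_smul, hQ, mul_zero])

theorem binForm_add (v w : F × F) :
    binForm a b f (v + w) = binForm a b f v + binForm a b f w + f * det2 v w
      + 2 * (a * v.1 * w.1 + b * v.2 * w.2) := by
  simp only [binForm, det2, Prod.fst_add, Prod.snd_add]; ring

/-- The chord condition. -/
theorem chord (h2 : (2 : F) = 0) {P : F × F} (hP : P ∈ centralConic a b f p₀ c) {t : F}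
    (ht : t ≠ 0) (w : F × F) :
    P + t • w ∈ centralConic a b f p₀ c ↔ t * binForm a b f w = f * det2 (P + p₀) w := by
  simp only [centralConic, Set.mem_ofPred_eq] at *
  rw [show P + t • w + p₀ = (P + p₀) + t • w by abel, binForm_add, hP, binForm_smul, h2]
  have : det2 (P + p₀) (t • w) = t * det2 (P + p₀) w := by
    simp only [det2, Prod.smul_fst, Prod.smul_snd, smul_eq_mul]; ring
  rw [this]
  constructor
  · intro h
    refine mul_left_cancel₀ ht ?_
    linear_combination h - t * f * det2 (P + p₀) w * h2
  · intro h
    linear_combination t * h + t * f * det2 (P + p₀) w * h2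

/-- No three points of an affine conic lie on a line. -/
theorem det2_sub_ne_zero (h2 : (2 : F) = 0) (hf : f ≠ 0) (hc : c ≠ 0) {P₀ P₁ P₂ : F × F}
    (h0 : P₀ ∈ centralConic a b f p₀ c) (h1 : P₁ ∈ centralConic a b f p₀ c)
    (hP2 : P₂ ∈ centralConic a b f p₀ c) (h01 : P₀ ≠ P₁) (h02 : P₀ ≠ P₂) (h12 : P₁ ≠ P₂) :
    det2 (P₁ - P₀) (P₂ - P₀) ≠ 0 := by
  intro h
  have hw : P₁ - P₀ ≠ 0 := sub_ne_zero.2 h01.symm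
  obtain ⟨s, hs⟩ := exists_smul_of_det2_eq_zero h2 hw h
  have hs0 : s ≠ 0 := by
    rintro rfl
    exact h02 (sub_eq_zero.1 (by simpa using hs)).symm
  have hs1 : s - 1 ≠ 0 := by
    intro h
    rw [sub_eq_zero.1 h, one_smul] at hs
    exact h12 (sub_left_injective hs).symm
  have e1 := (chord h2 h0 one_ne_zero (P₁ - P₀)).1 (by simpa using h1)
  have e2 := (chord h2 h0 hs0 (P₁ - P₀)).1 (by rw [← hs]; simpa using hP2)
  -- The chord condition at the parameters `1` and `s` differs by `(s - 1) Q(P₁ - P₀)`. So the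
  -- direction is isotropic and orthogonal to `P₀ + p₀`, hence parallel to it, against `c ≠ 0`.
  have hQ : binForm a b f (P₁ - P₀) = 0 := by
    refine (mul_eq_zero.1 ?_).resolve_left hs1
    linear_combination e2 - e1
  have hd : det2 (P₁ - P₀) (P₀ + p₀) ≠ 0 := det2_ne_zero_of_binForm h2 hw
    (by simp only [centralConic, Set.mem_ofPred_eq] at h0; rw [h0]; exact hc) hQ
  rw [hQ, mul_zero] at e2
  refine hd ?_
  have := (mul_eq_zero.1 e2.symm).resolve_left hf
  simp only [det2] at *
  linear_combination this

/-- The value of the form at the solution of two orthogonality conditions. -/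
theorem binForm_mul_sq (h2 : (2 : F) = 0) {v w₁ w₂ : F × F} {t : F}
    (e1 : t * binForm a b f w₁ = f * det2 v w₁) (e2 : t * binForm a b f w₂ = f * det2 v w₂) :
    binForm a b f v * (f * det2 w₁ w₂) ^ 2 = t ^ 2 *
      (binForm a b f w₁ * binForm a b f w₂ * binForm a b f (w₁ + w₂)) := by
  -- Cramer's rule for `v` in terms of `w₁, w₂`, multiplied out so that independence is not needed.
  have key : (f * det2 w₁ w₂) • v
      = t • (binForm a b f w₂ • w₁ + binForm a b f w₁ • w₂) := by
    rw [smul_add, smul_smul, smul_smul, e1, e2]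
    ext
    · simp only [det2, Prod.smul_fst, Prod.fst_add, smul_eq_mul]
      linear_combination (- f * v.2 * w₁.1 * w₂.1) * h2
    · simp only [det2, Prod.smul_snd, Prod.snd_add, smul_eq_mul]
      linear_combination (- f * v.1 * w₁.2 * w₂.2) * h2
  have h := congrArg (binForm a b f) key
  rw [binForm_smul, binForm_smul, binForm_add, binForm_smul, binForm_smul, h2] at h
  rw [binForm_add, h2]
  have hd : det2 (binForm a b f w₂ • w₁) (binForm a b f w₁ • w₂)
      = binForm a b f w₁ * binForm a b f w₂ * det2 w₁ w₂ := by
    simp only [det2, Prod.smul_fst, Prod.smul_snd, smul_eq_mul]; ring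
  rw [hd] at h
  linear_combination h

/-- Coordinates with respect to two independent vectors. -/
theorem exists_coords (h2 : (2 : F) = 0) (k : Subfield F) {w₁ w₂ w : F × F}
    (h : det2 w₁ w₂ ≠ 0) (h1 : w₁.1 ∈ k ∧ w₁.2 ∈ k) (hw2 : w₂.1 ∈ k ∧ w₂.2 ∈ k)
    (hw : w.1 ∈ k ∧ w.2 ∈ k) : ∃ x ∈ k, ∃ y ∈ k, w = x • w₁ + y • w₂ := by
  have hdk : ∀ {u v : F × F}, u.1 ∈ k ∧ u.2 ∈ k → v.1 ∈ k ∧ v.2 ∈ k → det2 u v ∈ k :=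
    fun hu hv => k.add_mem (k.mul_mem hu.1 hv.2) (k.mul_mem hu.2 hv.1)
  refine ⟨det2 w w₂ / det2 w₁ w₂, k.div_mem (hdk hw hw2) (hdk h1 hw2),
    det2 w w₁ / det2 w₁ w₂, k.div_mem (hdk hw h1) (hdk h1 hw2), ?_⟩
  ext
  · simp only [Prod.smul_fst, Prod.fst_add, smul_eq_mul]
    field_simp
    simp only [det2]
    linear_combination -(w.2 * w₁.1 * w₂.1) * h2
  · simp only [Prod.smul_snd, Prod.snd_add, smul_eq_mul]
    field_simp
    simp only [det2]
    linear_combination -(w.1 * w₁.2 * w₂.2) * h2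

end Algebra

/-! ### Intersections of Hall lines with a central conic -/

section Lines

variable {F : Type*} [Field F] {a b f c : F} {p₀ : F × F}

/-- The vectors with both coordinates in the subfield. -/
def subPlane (k : Subfield F) : Set (F × F) := {w | w.1 ∈ k ∧ w.2 ∈ k}

theorem smul_add_smul_mem_subPlane {k : Subfield F} {x y : F} {w₁ w₂ : F × F} (hx : x ∈ k)
    (hy : y ∈ k) (h1 : w₁ ∈ subPlane k) (h2 : w₂ ∈ subPlane k) : x • w₁ + y • w₂ ∈ subPlane k :=
  ⟨k.add_mem (k.mul_mem hx h1.1) (k.mul_mem hy h2.1),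
    k.add_mem (k.mul_mem hx h1.2) (k.mul_mem hy h2.2)⟩

/-- The form is proportional to one defined over the subfield `k`. -/
def DefinedOver (k : Subfield F) (a b f : F) : Prop :=
  ∃ d : F, ∀ w ∈ subPlane k, ∃ z ∈ k, binForm a b f w = d * z

theorem binForm_smul_add_smul (h2 : (2 : F) = 0) (x y : F) (w₁ w₂ : F × F) :
    binForm a b f (x • w₁ + y • w₂) = binForm a b f w₁ * x ^ 2
      + f * det2 w₁ w₂ * (x * y) + binForm a b f w₂ * y ^ 2 := by
  rw [binForm_add, h2, binForm_smul, binForm_smul]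
  simp only [det2, Prod.smul_fst, Prod.smul_snd, smul_eq_mul]; ring

/-- Two different solutions over `k` would put `A / B` in `k`, and then `C / B` too, so the whole
form would be `B` times a form over `k`. -/
theorem ratio_unique {k : Subfield F} {A B C : F} (hB : B ≠ 0)
    (hN : ¬ ∃ d : F, ∀ x ∈ k, ∀ y ∈ k, ∃ z ∈ k, A * x ^ 2 + C * (x * y) + B * y ^ 2 = d * z)
    {r s r' s' : F} (hr : r ∈ k) (hs : s ∈ k) (hr' : r' ∈ k) (hs' : s' ∈ k)
    (h : A * r + B * s = C) (h' : A * r' + B * s' = C) : r = r' ∧ s = s' := by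
  by_cases hrr : r = r'
  · subst hrr
    exact ⟨rfl, mul_left_cancel₀ hB (by linear_combination h - h')⟩
  · exfalso
    have hd : r - r' ≠ 0 := sub_ne_zero.2 hrr
    set σ := (s' - s) / (r - r') with hσ
    have hσk : σ ∈ k := k.div_mem (k.sub_mem hs' hs) (k.sub_mem hr hr')
    have hA : A = B * σ := by
      rw [hσ]; field_simp; linear_combination h - h'
    refine hN ⟨B, fun x hx y hy => ⟨σ * x ^ 2 + (σ * r + s) * (x * y) + y ^ 2, ?_, ?_⟩⟩
    · exact k.add_mem (k.add_mem (k.mul_mem hσk (k.pow_mem hx 2))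
        (k.mul_mem (k.add_mem (k.mul_mem hσk hr) hs) (k.mul_mem hx hy))) (k.pow_mem hy 2)
    · rw [← h, hA]; ring

theorem not_definedOver_basis (h2 : (2 : F) = 0) {k : Subfield F} (hN : ¬ DefinedOver k a b f)
    {w₁ w₂ : F × F} (h : det2 w₁ w₂ ≠ 0) (h1 : w₁ ∈ subPlane k) (hw2 : w₂ ∈ subPlane k) :
    ¬ ∃ d : F, ∀ x ∈ k, ∀ y ∈ k, ∃ z ∈ k, binForm a b f w₁ * x ^ 2
      + f * det2 w₁ w₂ * (x * y) + binForm a b f w₂ * y ^ 2 = d * z := by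
  rintro ⟨d, hd⟩
  refine hN ⟨d, fun w hw => ?_⟩
  obtain ⟨x, hx, y, hy, rfl⟩ := exists_coords h2 k h h1 hw2 hw
  rw [binForm_smul_add_smul h2]
  exact hd x hx y hy

theorem newLines_direction {k : Subfield F} {L : Set (F × F)} (hL : L ∈ newLines k) :
    ∃ t : F, t ≠ 0 ∧ ∀ P ∈ L, ∀ P' ∈ L, ∃ w ∈ subPlane k, P' = P + t • w := by
  obtain ⟨a, b, t, ht, rfl⟩ := hL
  refine ⟨t, ht, ?_⟩
  rintro _ ⟨u, hu, v, hv, rfl⟩ _ ⟨u', hu', v', hv', rfl⟩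
  refine ⟨(u' - u, v' - v), ⟨k.sub_mem hu' hu, k.sub_mem hv' hv⟩, ?_⟩
  ext
  · simp only [Prod.smul_mk, Prod.mk_add_mk, smul_eq_mul]; ring
  · simp only [Prod.smul_mk, Prod.mk_add_mk, smul_eq_mul]; ring

theorem det2_smul_smul (t : F) (v w : F × F) : det2 (t • v) (t • w) = t ^ 2 * det2 v w := by
  simp only [det2, Prod.smul_fst, Prod.smul_snd, smul_eq_mul]; ring

/-- The facts about two chords of a conic that lie in a common new line. -/
theorem chord_pair (h2 : (2 : F) = 0) (hf : f ≠ 0) (hc : c ≠ 0) {t : F} (ht : t ≠ 0)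
    {P w₁ w₂ : F × F} (h0 : P ∈ centralConic a b f p₀ c)
    (h1 : P + t • w₁ ∈ centralConic a b f p₀ c) (hP2 : P + t • w₂ ∈ centralConic a b f p₀ c)
    (hw1 : w₁ ≠ 0) (hw2 : w₂ ≠ 0) (h12 : w₁ ≠ w₂) :
    det2 w₁ w₂ ≠ 0 ∧ binForm a b f w₁ ≠ 0 ∧ binForm a b f w₂ ≠ 0 ∧
      binForm a b f (w₁ + w₂) ≠ 0 := by
  have hd : det2 w₁ w₂ ≠ 0 := by
    have := det2_sub_ne_zero h2 hf hc h0 h1 hP2 (by simp [ht, hw1]) (by simp [ht, hw2])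
      (by simp [ht, h12])
    rw [add_sub_cancel_left, add_sub_cancel_left, det2_smul_smul] at this
    exact right_ne_zero_of_mul this
  -- The left side of this identity is nonzero, so no factor on the right vanishes.
  have e := binForm_mul_sq h2 ((chord h2 h0 ht w₁).1 h1) ((chord h2 h0 ht w₂).1 hP2)
  have h0' : binForm a b f (P + p₀) = c := h0
  rw [h0'] at e
  have hne : c * (f * det2 w₁ w₂) ^ 2 ≠ 0 := mul_ne_zero hc (pow_ne_zero _ (mul_ne_zero hf hd))
  rw [e] at hne
  have h3 := right_ne_zero_of_mul hne
  exact ⟨hd, left_ne_zero_of_mul (left_ne_zero_of_mul h3),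
    right_ne_zero_of_mul (left_ne_zero_of_mul h3), right_ne_zero_of_mul h3⟩

/-- The coordinates of a fourth point of a conic on a new line. -/
theorem fourth_point (h2 : (2 : F) = 0) (hf : f ≠ 0) (hc : c ≠ 0) {k : Subfield F} {t : F}
    (ht : t ≠ 0) {P w₁ w₂ w₃ : F × F} (h0 : P ∈ centralConic a b f p₀ c)
    (h1 : P + t • w₁ ∈ centralConic a b f p₀ c) (hP2 : P + t • w₂ ∈ centralConic a b f p₀ c)
    (h3 : P + t • w₃ ∈ centralConic a b f p₀ c)
    (hw1 : w₁ ≠ 0) (hw2 : w₂ ≠ 0) (hw3 : w₃ ≠ 0) (h12 : w₁ ≠ w₂) (h13 : w₁ ≠ w₃) (h23 : w₂ ≠ w₃)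
    (hk1 : w₁ ∈ subPlane k) (hk2 : w₂ ∈ subPlane k) (hk3 : w₃ ∈ subPlane k) :
    ∃ x ∈ k, ∃ y ∈ k, x ≠ 0 ∧ y ≠ 0 ∧ x + y ≠ 1 ∧ w₃ = x • w₁ + y • w₂ ∧
      binForm a b f w₁ * ((x + 1) / y) + binForm a b f w₂ * ((y + 1) / x)
        = f * det2 w₁ w₂ := by
  have hd := (chord_pair h2 hf hc ht h0 h1 hP2 hw1 hw2 h12).1
  have hd13 := (chord_pair h2 hf hc ht h0 h1 h3 hw1 hw3 h13).1
  have hd23 := (chord_pair h2 hf hc ht h0 hP2 h3 hw2 hw3 h23).1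
  have hd4 := det2_sub_ne_zero h2 hf hc h1 hP2 h3 (by simp [ht, h12]) (by simp [ht, h13])
      (by simp [ht, h23])
  rw [add_sub_add_left_eq_sub, add_sub_add_left_eq_sub, ← smul_sub, ← smul_sub,
    det2_smul_smul] at hd4
  have hd5 := right_ne_zero_of_mul hd4
  obtain ⟨x, hx, y, hy, rfl⟩ := exists_coords h2 k hd hk1 hk2 hk3
  have c1 := (chord h2 h0 ht w₁).1 h1
  have c2 := (chord h2 h0 ht w₂).1 hP2
  have c3 := (chord h2 h0 ht _).1 h3
  have hx0 : x ≠ 0 := by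
    rintro rfl
    refine hd23 ?_
    simp only [det2, Prod.smul_fst, Prod.smul_snd, Prod.fst_add, Prod.snd_add, smul_eq_mul]
    linear_combination (y * w₂.1 * w₂.2) * h2
  have hy0 : y ≠ 0 := by
    rintro rfl
    refine hd13 ?_
    simp only [det2, Prod.smul_fst, Prod.smul_snd, Prod.fst_add, Prod.snd_add, smul_eq_mul]
    linear_combination (x * w₁.1 * w₁.2) * h2
  refine ⟨x, hx, y, hy, hx0, hy0, ?_, rfl, ?_⟩
  -- If `x + y = 1`, the fourth point is on the affine line joining the second and third.
  · intro hxy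
    refine hd5 ?_
    have : x = 1 - y := by linear_combination hxy
    subst this
    simp only [det2, Prod.smul_fst, Prod.smul_snd, Prod.fst_add, Prod.snd_add, smul_eq_mul,
      Prod.fst_sub, Prod.snd_sub]
    linear_combination (y * (w₂.1 - w₁.1) * (w₂.2 - w₁.2)) * h2
  -- Comparing the third chord condition with the combination of the first two gives `Q(x w₁ + y w₂)
  -- = x Q(w₁) + y Q(w₂)`, to be divided by `x y`.
  · rw [binForm_smul_add_smul h2] at c3
    have hl : f * det2 (P + p₀) (x • w₁ + y • w₂)
        = x * (f * det2 (P + p₀) w₁) + y * (f * det2 (P + p₀) w₂) := by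
      simp only [det2, Prod.smul_fst, Prod.smul_snd, Prod.fst_add, Prod.snd_add, smul_eq_mul]
      ring
    rw [hl, ← c1, ← c2] at c3
    have c4 : binForm a b f w₁ * x ^ 2 + f * det2 w₁ w₂ * (x * y) + binForm a b f w₂ * y ^ 2
        = x * binForm a b f w₁ + y * binForm a b f w₂ :=
      mul_left_cancel₀ ht (by linear_combination c3)
    field_simp
    linear_combination c4 + (binForm a b f w₁ * x + binForm a b f w₂ * y
      - f * det2 w₁ w₂ * (x * y)) * h2

/-- When `r s = 1`, the equations `x + 1 = r y` and `y + 1 = s x` are consistent only for `r = 1`.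
That is the collinear configuration excluded in `fourth_point`. -/
theorem reciprocal_ratio (h2 : (2 : F) = 0) {x y r s : F} (hx : x ≠ 0) (hy : y ≠ 0)
    (hrs : r * s = 1) (hr : (x + 1) / y = r) (hs : (y + 1) / x = s) : x + y = 1 := by
  rw [div_eq_iff hy] at hr
  rw [div_eq_iff hx] at hs
  have : r = 1 := by linear_combination r * hs + x * hrs + hr - h2
  subst this
  linear_combination hr + (y - 1) * h2

variable [Finite F]

theorem ncard_oldLines_inter_le (h2 : (2 : F) = 0) (hf : f ≠ 0) (hc : c ≠ 0) {k : Subfield F}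
    {L : Set (F × F)} (hL : L ∈ oldLines k) : (L ∩ centralConic a b f p₀ c).ncard ≤ 2 := by
  by_contra! h
  obtain ⟨P, Q, R, ⟨hP, hP'⟩, ⟨hQ, hQ'⟩, ⟨hR, hR'⟩, hPQ, hPR, hQR⟩ :=
    (Set.two_lt_ncard_iff (Set.toFinite _)).1 h
  obtain ⟨m, b, hm, rfl⟩ := hL
  have hP : P.2 = m * P.1 + b := hP
  have hQ : Q.2 = m * Q.1 + b := hQ
  have hR : R.2 = m * R.1 + b := hR
  refine det2_sub_ne_zero h2 hf hc hP' hQ' hR' hPQ hPR hQR ?_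
  simp only [det2, Prod.fst_sub, Prod.snd_sub, hP, hQ, hR]
  linear_combination (m * (Q.1 - P.1) * (R.1 - P.1)) * h2

theorem ncard_newLines_inter_le_four (h2 : (2 : F) = 0) (hf : f ≠ 0) (hc : c ≠ 0)
    {k : Subfield F} (hN : ¬ DefinedOver k a b f)
    {L : Set (F × F)} (hL : L ∈ newLines k) : (L ∩ centralConic a b f p₀ c).ncard ≤ 4 := by
  by_cases h : 2 < (L ∩ centralConic a b f p₀ c).ncard
  swap
  · omega
  obtain ⟨P, Q, R, ⟨hP, hP'⟩, ⟨hQ, hQ'⟩, ⟨hR, hR'⟩, hPQ, hPR, hQR⟩ :=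
    (Set.two_lt_ncard_iff (Set.toFinite _)).1 h
  obtain ⟨t, ht, hd⟩ := newLines_direction hL
  obtain ⟨w₁, hk1, rfl⟩ := hd P hP Q hQ
  obtain ⟨w₂, hk2, rfl⟩ := hd P hP R hR
  have hw1 : w₁ ≠ 0 := by simpa [ht] using hPQ
  have hw2 : w₂ ≠ 0 := by simpa [ht] using hPR
  have h12 : w₁ ≠ w₂ := by simpa [ht] using hQR
  obtain ⟨hdet, hQ1, hQ2, -⟩ := chord_pair h2 hf hc ht hP' hQ' hR' hw1 hw2 h12
  have hone : ((L ∩ centralConic a b f p₀ c) \ {P, P + t • w₁, P + t • w₂}).ncard ≤ 1 := by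
    rw [Set.ncard_le_one (Set.toFinite _)]
    rintro S ⟨⟨hS, hS'⟩, hSn⟩ T ⟨⟨hT, hT'⟩, hTn⟩
    obtain ⟨w₃, hk3, rfl⟩ := hd P hP S hS
    obtain ⟨w₄, hk4, rfl⟩ := hd P hP T hT
    simp only [Set.mem_insert_iff, Set.mem_singleton_iff, not_or, add_right_inj, add_eq_left,
      smul_eq_zero, ht, false_or, smul_right_injective (F × F) ht |>.eq_iff] at hSn hTn
    obtain ⟨x, hx, y, hy, hx0, hy0, hxy, rfl, e⟩ := fourth_point h2 hf hc ht hP' hQ' hR' hS'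
      hw1 hw2 hSn.1 h12 (Ne.symm hSn.2.1) (Ne.symm hSn.2.2) hk1 hk2 hk3
    obtain ⟨x', hx', y', hy', hx0', hy0', hxy', rfl, e'⟩ := fourth_point h2 hf hc ht hP' hQ' hR'
      hT' hw1 hw2 hTn.1 h12 (Ne.symm hTn.2.1) (Ne.symm hTn.2.2) hk1 hk2 hk4
    obtain ⟨hr, hs⟩ := ratio_unique hQ2 (not_definedOver_basis h2 hN hdet hk1 hk2)
      (k.div_mem (k.add_mem hx k.one_mem) hy) (k.div_mem (k.add_mem hy k.one_mem) hx)
      (k.div_mem (k.add_mem hx' k.one_mem) hy') (k.div_mem (k.add_mem hy' k.one_mem) hx') e e'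
    by_contra hne
    -- Both `(x, y)` and `(x', y')` solve the linear system with the same `r, s`. Their nonzero
    -- difference lies in its kernel, so the determinant condition `r s = 1` holds.
    have hrs : (x' + 1) / y' * ((y' + 1) / x') = 1 := by
      set r := (x' + 1) / y' with hrd
      set s := (y' + 1) / x' with hsd
      rw [div_eq_iff hy0] at hr
      rw [div_eq_iff hx0] at hs
      rw [eq_div_iff hy0'] at hrd
      rw [eq_div_iff hx0'] at hsd
      have e1 : x - x' = r * (y - y') := by linear_combination hr + hrd
      have e2 : y - y' = s * (x - x') := by linear_combination hs + hsd
      have hxx : x - x' ≠ 0 := by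
        intro h0
        rw [h0, mul_zero] at e2
        rw [sub_eq_zero.1 h0, sub_eq_zero.1 e2] at hne
        exact hne rfl
      exact mul_right_cancel₀ hxx (by linear_combination -e1 - r * e2)
    exact hxy' (reciprocal_ratio h2 hx0' hy0' hrs rfl rfl)
  have h3 : ({P, P + t • w₁, P + t • w₂} : Set (F × F)).ncard ≤ 3 :=
    (Set.ncard_insert_le _ _).trans (Nat.add_le_add_right
      ((Set.ncard_insert_le _ _).trans (by rw [Set.ncard_singleton])) 1)
  have := Set.ncard_le_ncard_sdiff_add_ncard (L ∩ centralConic a b f p₀ c)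
    {P, P + t • w₁, P + t • w₂} (Set.toFinite _)
  omega

theorem ncard_newLines_inter_le_three (h2 : (2 : F) = 0) (hf : f ≠ 0) (hc : c ≠ 0)
    {k : Subfield F} (hN : ¬ DefinedOver k a b f) {p : F × F} (hp : p ∈ subPlane k) (hp0 : p ≠ 0)
    (hQp : binForm a b f p = 0)
    {L : Set (F × F)} (hL : L ∈ newLines k) : (L ∩ centralConic a b f p₀ c).ncard ≤ 3 := by
  by_cases h : 2 < (L ∩ centralConic a b f p₀ c).ncard
  swap
  · omega
  obtain ⟨P, Q, R, ⟨hP, hP'⟩, ⟨hQ, hQ'⟩, ⟨hR, hR'⟩, hPQ, hPR, hQR⟩ :=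
    (Set.two_lt_ncard_iff (Set.toFinite _)).1 h
  obtain ⟨t, ht, hd⟩ := newLines_direction hL
  obtain ⟨w₁, hk1, rfl⟩ := hd P hP Q hQ
  obtain ⟨w₂, hk2, rfl⟩ := hd P hP R hR
  have hw1 : w₁ ≠ 0 := by simpa [ht] using hPQ
  have hw2 : w₂ ≠ 0 := by simpa [ht] using hPR
  have h12 : w₁ ≠ w₂ := by simpa [ht] using hQR
  obtain ⟨hdet, hQ1, hQ2, -⟩ := chord_pair h2 hf hc ht hP' hQ' hR' hw1 hw2 h12
  obtain ⟨x₀, hx₀, y₀, hy₀, rfl⟩ := exists_coords h2 k hdet hk1 hk2 hp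
  rw [binForm_smul_add_smul h2] at hQp
  have hx₀0 : x₀ ≠ 0 := by
    rintro rfl
    have : y₀ ≠ 0 := by rintro rfl; simp at hp0
    simp [hQ2, this] at hQp
  have hy₀0 : y₀ ≠ 0 := by
    rintro rfl
    simp [hQ1, hx₀0] at hQp
  have hsub : L ∩ centralConic a b f p₀ c ⊆ {P, P + t • w₁, P + t • w₂} := by
    rintro S ⟨hS, hS'⟩
    by_contra hSn
    obtain ⟨w₃, hk3, rfl⟩ := hd P hP S hS
    simp only [Set.mem_insert_iff, Set.mem_singleton_iff, not_or, add_right_inj, add_eq_left,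
      smul_eq_zero, ht, false_or, smul_right_injective (F × F) ht |>.eq_iff] at hSn
    obtain ⟨x, hx, y, hy, hx0, hy0, hxy, rfl, e⟩ := fourth_point h2 hf hc ht hP' hQ' hR' hS'
      hw1 hw2 hSn.1 h12 (Ne.symm hSn.2.1) (Ne.symm hSn.2.2) hk1 hk2 hk3
    -- The isotropic vector `x₀ w₁ + y₀ w₂` yields another solution of the ratio equation, one with
    -- product 1; by uniqueness it is that of the fourth point.
    have e' : binForm a b f w₁ * (x₀ / y₀) + binForm a b f w₂ * (y₀ / x₀)
        = f * det2 w₁ w₂ := by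
      field_simp
      linear_combination hQp - f * det2 w₁ w₂ * (x₀ * y₀) * h2
    obtain ⟨hr, hs⟩ := ratio_unique hQ2 (not_definedOver_basis h2 hN hdet hk1 hk2)
      (k.div_mem (k.add_mem hx k.one_mem) hy) (k.div_mem (k.add_mem hy k.one_mem) hx)
      (k.div_mem hx₀ hy₀) (k.div_mem hy₀ hx₀) e e'
    exact hxy (reciprocal_ratio h2 hx0 hy0 (by field_simp) hr hs)
  have h3 : ({P, P + t • w₁, P + t • w₂} : Set (F × F)).ncard ≤ 3 :=
    (Set.ncard_insert_le _ _).trans (Nat.add_le_add_right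
      ((Set.ncard_insert_le _ _).trans (by rw [Set.ncard_singleton])) 1)
  exact (Set.ncard_le_ncard hsub (Set.toFinite _)).trans h3

end Lines

/-! ### Counting collinear triples by double counting -/

theorem ncard_eq_mul_of_fibers {α β : Type*} [Finite α] [Finite β] {s : Set α} {t : Set β}
    (g : α → β) (hg : Set.MapsTo g s t) (n : ℕ)
    (h : ∀ y ∈ t, {x ∈ s | g x = y}.ncard = n) : s.ncard = n * t.ncard := by
  classical
  have := Fintype.ofFinite α
  have := Fintype.ofFinite β
  rw [Set.ncard_eq_toFinset_card', Set.ncard_eq_toFinset_card',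
    Finset.card_eq_sum_card_fiberwise (f := g) (t := t.toFinset) (by simpa using hg),
    Finset.sum_const_nat (m := n), mul_comm]
  intro y hy
  rw [← h y (by simpa using hy), Set.ncard_eq_toFinset_card']
  congr 1
  ext x
  simp

section Counting

variable {F : Type*} [Field F] {a b f c : F} {p₀ : F × F}

/-- Ordered triples of distinct points of `A` on a common new line. -/
def orderedTriples (k : Subfield F) (A : Set (F × F)) : Set ((F × F) × (F × F) × (F × F)) :=
  {T | (T.1 ∈ A ∧ T.2.1 ∈ A ∧ T.2.2 ∈ A) ∧ (T.1 ≠ T.2.1 ∧ T.1 ≠ T.2.2 ∧ T.2.1 ≠ T.2.2) ∧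
    ∃ L ∈ newLines k, T.1 ∈ L ∧ T.2.1 ∈ L ∧ T.2.2 ∈ L}

/-- Ordered triples `P, P + t w₁, P + t w₂` of points of `A` with a scale `t` and `k`-rational
directions. -/
def scaledTriples (k : Subfield F) (A : Set (F × F)) : Set ((F × F) × F × (F × F) × (F × F)) :=
  {T | T.2.1 ≠ 0 ∧ (T.2.2.1 ∈ subPlane k ∧ T.2.2.2 ∈ subPlane k) ∧
    (T.2.2.1 ≠ 0 ∧ T.2.2.2 ≠ 0 ∧ T.2.2.1 ≠ T.2.2.2) ∧
    (T.1 ∈ A ∧ T.1 + T.2.1 • T.2.2.1 ∈ A ∧ T.1 + T.2.1 • T.2.2.2 ∈ A)}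

/-- Pairs of independent `k`-rational vectors spanning an anisotropic triangle. -/
def anisotropicPairs (k : Subfield F) (a b f : F) : Set ((F × F) × (F × F)) :=
  {w | (w.1 ∈ subPlane k ∧ w.2 ∈ subPlane k) ∧ det2 w.1 w.2 ≠ 0 ∧
    binForm a b f w.1 ≠ 0 ∧ binForm a b f w.2 ≠ 0 ∧ binForm a b f (w.1 + w.2) ≠ 0}

theorem sq_injective (h2 : (2 : F) = 0) : Function.Injective (fun x : F => x ^ 2) := by
  intro x y h
  have h : x ^ 2 = y ^ 2 := h
  have : (x - y) ^ 2 = 0 := by linear_combination h + (y ^ 2 - x * y) * h2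
  exact sub_eq_zero.1 (pow_eq_zero_iff two_ne_zero |>.1 this)

theorem eq_of_det2_eq (h2 : (2 : F) = 0) {v v' w₁ w₂ : F × F} (hd : det2 w₁ w₂ ≠ 0)
    (e1 : det2 v w₁ = det2 v' w₁) (e2 : det2 v w₂ = det2 v' w₂) : v = v' := by
  simp only [det2] at *
  ext
  · refine mul_left_cancel₀ hd ?_
    linear_combination w₂.1 * e1 + w₁.1 * e2 - (v.2 - v'.2) * w₁.1 * w₂.1 * h2
  · refine mul_left_cancel₀ hd ?_
    linear_combination w₂.2 * e1 + w₁.2 * e2 - (v.1 - v'.1) * w₁.2 * w₂.2 * h2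

theorem ncard_subfield_sdiff_zero (k : Subfield F) :
    ((k : Set F) \ {0}).ncard = Nat.card k - 1 := by
  rw [Set.ncard_sdiff_singleton_of_mem k.zero_mem]
  rfl

variable [Finite F]

/-- The scale `t` is the unique square root prescribed by `binForm_mul_sq`, and the base point is
then fixed by its pairings with the independent vectors `w₁, w₂`. -/
theorem bijOn_scaledTriples (h2 : (2 : F) = 0) (hf : f ≠ 0) (hc : c ≠ 0) (k : Subfield F) :
    Set.BijOn (fun T : (F × F) × F × (F × F) × (F × F) => T.2.2)
      (scaledTriples k (centralConic a b f p₀ c)) (anisotropicPairs k a b f) := by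
  refine ⟨?_, ?_, ?_⟩
  · rintro ⟨P, t, w₁, w₂⟩ ⟨ht, hk, ⟨hw1, hw2, h12⟩, h0, h1, hP2⟩
    exact ⟨hk, chord_pair h2 hf hc ht h0 h1 hP2 hw1 hw2 h12⟩
  · rintro ⟨P, t, w₁, w₂⟩ ⟨ht, hk, ⟨hw1, hw2, h12⟩, h0, h1, hP2⟩ ⟨P', t', w₁', w₂'⟩
      ⟨ht', -, -, h0', h1', hP2'⟩ h
    simp only [Prod.mk.injEq] at h
    obtain ⟨rfl, rfl⟩ := h
    dsimp only at *
    obtain ⟨hd, hQ1, hQ2, hQ12⟩ := chord_pair h2 hf hc ht h0 h1 hP2 hw1 hw2 h12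
    have c1 := (chord h2 h0 ht w₁).1 h1
    have c2 := (chord h2 h0 ht w₂).1 hP2
    have c1' := (chord h2 h0' ht' w₁).1 h1'
    have c2' := (chord h2 h0' ht' w₂).1 hP2'
    have e := binForm_mul_sq h2 c1 c2
    have e' := binForm_mul_sq h2 c1' c2'
    have hv : binForm a b f (P + p₀) = c := h0
    have hv' : binForm a b f (P' + p₀) = c := h0'
    rw [hv] at e
    rw [hv', e] at e'
    have htt : t = t' := sq_injective h2
      (mul_right_cancel₀ (mul_ne_zero (mul_ne_zero hQ1 hQ2) hQ12) e')
    subst htt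
    have := eq_of_det2_eq h2 hd (mul_left_cancel₀ hf (c1.symm.trans c1'))
      (mul_left_cancel₀ hf (c2.symm.trans c2'))
    rw [add_right_cancel this]
  · rintro ⟨w₁, w₂⟩ ⟨hk, hd, hQ1, hQ2, hQ12⟩
    dsimp only at *
    have hB : f * det2 w₁ w₂ ≠ 0 := mul_ne_zero hf hd
    obtain ⟨t, ht⟩ := Finite.surjective_of_injective (sq_injective h2)
      (c * (f * det2 w₁ w₂) ^ 2 / (binForm a b f w₁ * binForm a b f w₂ * binForm a b f (w₁ + w₂)))
    have ht : t ^ 2 = _ := ht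
    have hQ : binForm a b f w₁ * binForm a b f w₂ * binForm a b f (w₁ + w₂) ≠ 0 :=
      mul_ne_zero (mul_ne_zero hQ1 hQ2) hQ12
    have ht0 : t ≠ 0 := by
      rintro rfl
      rw [zero_pow two_ne_zero] at ht
      exact div_ne_zero (mul_ne_zero hc (pow_ne_zero 2 hB)) hQ ht.symm
    rw [eq_div_iff hQ] at ht
    -- The Cramer solution of the two chord conditions; the choice of `t` then makes `Q(v) = c`.
    set v : F × F := (t / (f * det2 w₁ w₂)) • (binForm a b f w₂ • w₁ + binForm a b f w₁ • w₂)
      with hv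
    have hdl : ∀ (r x y : F) (w : F × F), det2 (r • (x • w₁ + y • w₂)) w
        = r * (x * det2 w₁ w + y * det2 w₂ w) := by
      intro r x y w
      simp only [det2, Prod.smul_fst, Prod.smul_snd, Prod.fst_add, Prod.snd_add, smul_eq_mul]
      ring
    have hself : ∀ w : F × F, det2 w w = 0 := by
      intro w; simp only [det2]; linear_combination w.1 * w.2 * h2
    have hsymm : det2 w₂ w₁ = det2 w₁ w₂ := by simp only [det2]; ring
    have c1 : t * binForm a b f w₁ = f * det2 v w₁ := by
      rw [hv, hdl, hself, hsymm]; field_simp; ring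
    have c2 : t * binForm a b f w₂ = f * det2 v w₂ := by
      rw [hv, hdl, hself]; field_simp; ring
    have e := binForm_mul_sq h2 c1 c2
    rw [ht] at e
    have hvc : binForm a b f v = c := mul_right_cancel₀ (pow_ne_zero 2 hB) e
    have h0 : v - p₀ ∈ centralConic a b f p₀ c := by
      change binForm a b f (v - p₀ + p₀) = c
      rwa [sub_add_cancel]
    refine ⟨(v - p₀, t, w₁, w₂), ⟨ht0, hk, ⟨?_, ?_, ?_⟩, h0, ?_, ?_⟩, rfl⟩
    · rintro rfl; simp [binForm] at hQ1
    · rintro rfl; simp [binForm] at hQ2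
    · intro h
      have h : w₁ = w₂ := h
      exact hd (h ▸ hself w₁)
    · rw [chord h2 h0 ht0, sub_add_cancel]; exact c1
    · rw [chord h2 h0 ht0, sub_add_cancel]; exact c2

/-- The triple fixes the scale only up to `k`-multiples: `(t, w₁, w₂)` and `(t l, l⁻¹ w₁, l⁻¹ w₂)`
give the same points for nonzero `l` in `k`. -/
theorem ncard_scaledTriples (k : Subfield F) (A : Set (F × F)) :
    (scaledTriples k A).ncard = (Nat.card k - 1) * (orderedTriples k A).ncard := by
  refine ncard_eq_mul_of_fibers (fun T => (T.1, T.1 + T.2.1 • T.2.2.1, T.1 + T.2.1 • T.2.2.2))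
    ?_ _ ?_
  · rintro ⟨P, t, w₁, w₂⟩ ⟨ht, hk, ⟨hw1, hw2, h12⟩, hA⟩
    dsimp only at *
    refine ⟨hA, ⟨?_, ?_, ?_⟩, {p | ∃ u ∈ k, ∃ v ∈ k, p = (P.1 + t * u, P.2 + t * v)},
      ⟨P.1, P.2, t, ht, rfl⟩, ⟨0, k.zero_mem, 0, k.zero_mem, ?_⟩,
      ⟨w₁.1, hk.1.1, w₁.2, hk.1.2, ?_⟩, ⟨w₂.1, hk.2.1, w₂.2, hk.2.2, ?_⟩⟩
    · simp [ht, hw1]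
    · simp [ht, hw2]
    · simp [ht, h12]
    · ext <;> simp
    · ext <;> simp
    · ext <;> simp
  · rintro ⟨P, Q, R⟩ ⟨⟨hP, hQ, hR⟩, ⟨hPQ, hPR, hQR⟩, L, hL, hPL, hQL, hRL⟩
    dsimp only at *
    obtain ⟨t, ht, hd⟩ := newLines_direction hL
    obtain ⟨w₁, hk1, rfl⟩ := hd P hPL Q hQL
    obtain ⟨w₂, hk2, rfl⟩ := hd P hPL R hRL
    have hw1 : w₁ ≠ 0 := by simpa [ht] using hPQ
    have hw2 : w₂ ≠ 0 := by simpa [ht] using hPR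
    have h12 : w₁ ≠ w₂ := by simpa [ht] using hQR
    rw [← ncard_subfield_sdiff_zero]
    symm
    refine Set.BijOn.ncard_eq (f := fun l : F => (P, t * l, l⁻¹ • w₁, l⁻¹ • w₂)) ⟨?_, ?_, ?_⟩
    · rintro l ⟨hl, hl0⟩
      have hl0 : l ≠ 0 := hl0
      have hli : l⁻¹ ∈ k := k.inv_mem hl
      have e : ∀ w : F × F, (t * l) • l⁻¹ • w = t • w := by
        intro w; rw [smul_smul, mul_assoc, mul_inv_cancel₀ hl0, mul_one]
      refine ⟨⟨mul_ne_zero ht hl0, ⟨⟨k.mul_mem hli hk1.1, k.mul_mem hli hk1.2⟩,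
        ⟨k.mul_mem hli hk2.1, k.mul_mem hli hk2.2⟩⟩, ⟨?_, ?_, ?_⟩, hP, ?_, ?_⟩, ?_⟩
      · simp [hl0, hw1]
      · simp [hl0, hw2]
      · simpa [hl0] using h12
      · simpa only [e] using hQ
      · simpa only [e] using hR
      · simp only [e]
    · intro l _ l' _ h
      simp only [Prod.mk.injEq] at h
      exact mul_left_cancel₀ ht h.2.1
    · rintro ⟨P', t', w₁', w₂'⟩ ⟨⟨ht', hk', hne, -⟩, he⟩
      simp only [Prod.mk.injEq] at he
      dsimp only at *
      obtain ⟨rfl, h1, h3⟩ := he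
      have h1 := add_left_cancel h1
      have h3 := add_left_cancel h3
      have hw : ∀ {w w' : F × F}, t' • w' = t • w → (t' / t)⁻¹ • w = w' := by
        intro w w' h
        rw [inv_div, div_eq_mul_inv, mul_comm, mul_smul, ← h, smul_smul, inv_mul_cancel₀ ht',
          one_smul]
      refine ⟨t' / t, ⟨?_, div_ne_zero ht' ht⟩, ?_⟩
      · have e1 : t' * w₁'.1 = t * w₁.1 := congrArg Prod.fst h1
        have e2 : t' * w₁'.2 = t * w₁.2 := congrArg Prod.snd h1
        -- A nonzero coordinate of `w₁'` exhibits `t' / t` as a quotient of elements of `k`.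
        by_cases hx : w₁'.1 = 0
        · have hy : w₁'.2 ≠ 0 := fun hy => hne.1 (Prod.ext hx hy)
          rw [show t' / t = w₁.2 / w₁'.2 by field_simp; linear_combination e2]
          exact k.div_mem hk1.2 hk'.1.2
        · rw [show t' / t = w₁.1 / w₁'.1 by field_simp; linear_combination e1]
          exact k.div_mem hk1.1 hk'.1.1
      · simp only [hw h1, hw h3, mul_div_cancel₀ _ ht]

theorem ncard_orderedTriples (h2 : (2 : F) = 0) (hf : f ≠ 0) (hc : c ≠ 0) (k : Subfield F) :
    (orderedTriples k (centralConic a b f p₀ c)).ncard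
      = 6 * (collinearTriples k (centralConic a b f p₀ c)).ncard := by
  classical
  refine ncard_eq_mul_of_fibers (fun T => ({T.1, T.2.1, T.2.2} : Finset (F × F))) ?_ _ ?_
  · rintro ⟨P, Q, R⟩ ⟨⟨hP, hQ, hR⟩, ⟨hPQ, hPR, hQR⟩, L, hL, hPL, hQL, hRL⟩
    refine ⟨Finset.card_eq_three.2 ⟨P, Q, R, hPQ, hPR, hQR, rfl⟩, ?_, L, Or.inr hL, ?_⟩
    · simp only [Finset.coe_insert, Finset.coe_singleton]
      rintro _ (rfl | rfl | rfl) <;> assumption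
    · simp only [Finset.coe_insert, Finset.coe_singleton]
      rintro _ (rfl | rfl | rfl) <;> assumption
  · rintro T ⟨hT, hTA, L, hL, hTL⟩
    -- An old line has at most two points on the conic, so the common line must be new.
    have hLn : L ∈ newLines k := by
      refine hL.resolve_left fun ho => ?_
      have := ncard_oldLines_inter_le (p₀ := p₀) (a := a) (b := b) h2 hf hc ho
      have h3 := Set.ncard_le_ncard (Set.subset_inter hTL hTA) (Set.toFinite _)
      rw [Set.ncard_coe_finset] at h3
      omega
    obtain ⟨x, y, z, hxy, hxz, hyz, rfl⟩ := Finset.card_eq_three.1 hT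
    have hA : ∀ p ∈ ({x, y, z} : Finset (F × F)), p ∈ centralConic a b f p₀ c :=
      fun p hp => hTA hp
    have hLL : ∀ p ∈ ({x, y, z} : Finset (F × F)), p ∈ L := fun p hp => hTL hp
    have hset : {T ∈ orderedTriples k (centralConic a b f p₀ c) |
        ({T.1, T.2.1, T.2.2} : Finset (F × F)) = {x, y, z}}
        = {(x, y, z), (x, z, y), (y, x, z), (y, z, x), (z, x, y), (z, y, x)} := by
      ext ⟨p, r, s⟩
      simp only [Set.mem_sep_iff, Set.mem_insert_iff, Set.mem_singleton_iff, Prod.mk.injEq]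
      constructor
      · rintro ⟨⟨-, ⟨hpr, hps, hrs⟩, -⟩, he⟩
        have hp : p ∈ ({x, y, z} : Finset (F × F)) := by rw [← he]; simp
        have hr : r ∈ ({x, y, z} : Finset (F × F)) := by rw [← he]; simp
        have hs : s ∈ ({x, y, z} : Finset (F × F)) := by rw [← he]; simp
        simp only [Finset.mem_insert, Finset.mem_singleton] at hp hr hs
        dsimp only at hpr hps hrs
        grind
      · intro h
        have he : ({p, r, s} : Finset (F × F)) = {x, y, z} := by
          ext u
          simp only [Finset.mem_insert, Finset.mem_singleton]
          grind
        rw [← he] at hA hLL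
        refine ⟨⟨⟨hA _ ?_, hA _ ?_, hA _ ?_⟩, ?_, L, hLn, hLL _ ?_, hLL _ ?_, hLL _ ?_⟩, he⟩
        all_goals first
          | (simp; done)
          | (dsimp only; grind)
    rw [hset]
    rw [Set.ncard_insert_of_notMem, Set.ncard_insert_of_notMem, Set.ncard_insert_of_notMem,
      Set.ncard_insert_of_notMem, Set.ncard_pair]
    all_goals
      simp only [Set.mem_insert_iff, Set.mem_singleton_iff, Prod.mk.injEq, ne_eq]
      grind

theorem ncard_collinearTriples (h2 : (2 : F) = 0) (hf : f ≠ 0) (hc : c ≠ 0) (k : Subfield F) :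
    (Nat.card k - 1) * (6 * (collinearTriples k (centralConic a b f p₀ c)).ncard)
      = (anisotropicPairs k a b f).ncard := by
  rw [← ncard_orderedTriples h2 hf hc, ← ncard_scaledTriples,
    (bijOn_scaledTriples h2 hf hc k).ncard_eq]

end Counting

/-! ### Numbers of anisotropic pairs -/

section PairCounts

variable {F : Type*} [Field F] [Finite F] {a b f : F}

theorem ncard_anisotropicPairs_of_anisotropic (h2 : (2 : F) = 0) (k : Subfield F)
    (hQ : ∀ w ∈ subPlane k, w ≠ 0 → binForm a b f w ≠ 0) :
    (anisotropicPairs k a b f).ncard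
      = (Nat.card k ^ 2 - 1) * (Nat.card k ^ 2 - Nat.card k) := by
  have := Fintype.ofFinite k
  have hGL := Matrix.card_GL_field (𝔽 := k) 2
  rw [Fin.prod_univ_two, Fintype.card_eq_nat_card] at hGL
  simp only [Fin.val_zero, Fin.val_one, pow_zero, pow_one] at hGL
  rw [← hGL, ← Set.ncard_univ]
  symm
  -- In characteristic two `det2` is the determinant, so the independent pairs are the rows of the
  -- matrices in `GL₂(k)`.
  have hdet : ∀ M : Matrix (Fin 2) (Fin 2) k, ((M.det : k) : F)
      = det2 ((M 0 0 : F), (M 0 1 : F)) ((M 1 0 : F), (M 1 1 : F)) := by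
    intro M
    rw [Matrix.det_fin_two]
    simp only [det2, Subfield.coe_sub, Subfield.coe_mul]
    linear_combination -((M 0 1 : F) * (M 1 0 : F)) * h2
  refine Set.BijOn.ncard_eq (f := fun M : GL (Fin 2) k =>
    ((((M 0 0 : k) : F), ((M 0 1 : k) : F)), (((M 1 0 : k) : F), ((M 1 1 : k) : F)))) ⟨?_, ?_, ?_⟩
  · intro M _
    have hM : M.1.det ≠ 0 := (Matrix.GeneralLinearGroup.det M).ne_zero
    have hd : det2 ((M 0 0 : F), (M 0 1 : F)) ((M 1 0 : F), (M 1 1 : F)) ≠ 0 := by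
      rw [← hdet]; simpa using hM
    refine ⟨⟨⟨(M 0 0).2, (M 0 1).2⟩, (M 1 0).2, (M 1 1).2⟩, hd, hQ _ ?_ ?_, hQ _ ?_ ?_, hQ _ ?_ ?_⟩
    · exact ⟨(M 0 0).2, (M 0 1).2⟩
    · intro h
      have e1 : (M 0 0 : F) = 0 := congrArg Prod.fst h
      have e2 : (M 0 1 : F) = 0 := congrArg Prod.snd h
      exact hd (by simp only [det2]; linear_combination (M 1 1 : F) * e1 + (M 1 0 : F) * e2)
    · exact ⟨(M 1 0).2, (M 1 1).2⟩
    · intro h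
      have e1 : (M 1 0 : F) = 0 := congrArg Prod.fst h
      have e2 : (M 1 1 : F) = 0 := congrArg Prod.snd h
      exact hd (by simp only [det2]; linear_combination (M 0 1 : F) * e1 + (M 0 0 : F) * e2)
    · exact ⟨k.add_mem (M 0 0).2 (M 1 0).2, k.add_mem (M 0 1).2 (M 1 1).2⟩
    · intro h
      have e1 : (M 0 0 : F) + (M 1 0 : F) = 0 := congrArg Prod.fst h
      have e2 : (M 0 1 : F) + (M 1 1 : F) = 0 := congrArg Prod.snd h
      refine hd ?_
      simp only [det2]
      linear_combination (M 1 1 : F) * e1 + (M 1 0 : F) * e2 - (M 1 0 : F) * (M 1 1 : F) * h2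
  · intro M _ N _ h
    simp only [Prod.mk.injEq, Subtype.coe_inj] at h
    ext i j
    fin_cases i <;> fin_cases j <;> simp [h]
  · rintro ⟨⟨x, y⟩, ⟨x', y'⟩⟩ ⟨⟨⟨hx, hy⟩, hx', hy'⟩, hd, -⟩
    set M : Matrix (Fin 2) (Fin 2) k := !![⟨x, hx⟩, ⟨y, hy⟩; ⟨x', hx'⟩, ⟨y', hy'⟩] with hM
    have hMd : M.det ≠ 0 := by
      intro h
      have := hdet M
      rw [h] at this
      exact hd (by simpa [hM] using this.symm)
    exact ⟨Matrix.GeneralLinearGroup.mkOfDetNeZero M hMd, trivial, rfl⟩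

theorem ncard_anisotropicPairs_of_isotropic (h2 : (2 : F) = 0) (k : Subfield F) {p : F × F}
    (hp : p ∈ subPlane k) (hp0 : p ≠ 0)
    (hQ : ∀ w ∈ subPlane k, binForm a b f w = 0 ↔ det2 w p = 0) :
    (anisotropicPairs k a b f).ncard
      = (Nat.card k - 1) * ((Nat.card k - 2) * (Nat.card k * (Nat.card k - 1))) := by
  obtain ⟨u, hu, hup⟩ : ∃ u ∈ subPlane k, det2 u p = 1 := by
    by_cases hx : p.1 = 0
    · have hy : p.2 ≠ 0 := fun hy => hp0 (Prod.ext hx hy)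
      exact ⟨(p.2⁻¹, 0), ⟨k.inv_mem hp.2, k.zero_mem⟩, by simp [det2, hy]⟩
    · exact ⟨(0, p.1⁻¹), ⟨k.zero_mem, k.inv_mem hp.1⟩, by simp [det2, hx]⟩
  have hpu : det2 p u = 1 := by rw [← hup]; simp only [det2]; ring
  have hself : ∀ w : F × F, det2 w w = 0 := by
    intro w; simp only [det2]; linear_combination w.1 * w.2 * h2
  have hl : ∀ (x y : F) (v v' w : F × F), det2 (x • v + y • v') w
      = x * det2 v w + y * det2 v' w := by
    intro x y v v' w
    simp only [det2, Prod.smul_fst, Prod.smul_snd, Prod.fst_add, Prod.snd_add, smul_eq_mul]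
    ring
  have h1 : ∀ x y : F, det2 (x • u + y • p) p = x := by
    intro x y; rw [hl, hup, hself]; ring
  have h1' : ∀ x y : F, det2 (x • u + y • p) u = y := by
    intro x y; rw [hl, hpu, hself]; ring
  have hadd : ∀ v w z : F × F, det2 (v + w) z = det2 v z + det2 w z := by
    intro v w z; simp only [det2, Prod.fst_add, Prod.snd_add]; ring
  have hdd : ∀ x y x' y' : F, det2 (x • u + y • p) (x' • u + y' • p) = x * y' - y * x' := by
    intro x y x' y'
    have hup' : u.1 * p.2 + u.2 * p.1 = 1 := hup
    simp only [det2, Prod.smul_fst, Prod.smul_snd, Prod.fst_add, Prod.snd_add, smul_eq_mul]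
    linear_combination (x * y' + y * x') * hup' + (y * x' + x * x' * u.1 * u.2
      + y * y' * p.1 * p.2) * h2
  have hk0 : ((k : Set F) \ {0, 1}).ncard = Nat.card k - 2 := by
    rw [Set.ncard_sdiff (by
      rintro _ (rfl | rfl)
      exacts [k.zero_mem, k.one_mem]), Set.ncard_pair zero_ne_one]
    rfl
  have hkc : (k : Set F).ncard = Nat.card k := rfl
  rw [← hk0, ← ncard_subfield_sdiff_zero, ← hkc, ← Set.ncard_prod, ← Set.ncard_prod,
    ← Set.ncard_prod]
  symm
  -- With `(s, σ, r, τ)`, the pair is `w₁ = s u + r p` and `w₂ = σ w₁ + τ p`. The conditions become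
  -- `s ≠ 0` for `w₁`, `σ ≠ 0` for `w₂`, `σ ≠ 1` for `w₁ + w₂`, and `τ ≠ 0` for independence.
  refine Set.BijOn.ncard_eq (f := fun z : F × F × F × F =>
    (z.1 • u + z.2.2.1 • p, (z.1 * z.2.1) • u + (z.2.2.1 * z.2.1 + z.2.2.2) • p)) ⟨?_, ?_, ?_⟩
  · rintro ⟨s, σ, r, τ⟩ ⟨⟨hs, hs0⟩, ⟨hσ, hσ01⟩, hr, hτ, hτ0⟩
    simp only [Set.mem_insert_iff, Set.mem_singleton_iff, not_or] at hs0 hσ01 hτ0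
    have hk1 : s • u + r • p ∈ subPlane k := smul_add_smul_mem_subPlane hs hr hu hp
    have hk2 : (s * σ) • u + (r * σ + τ) • p ∈ subPlane k :=
      smul_add_smul_mem_subPlane (k.mul_mem hs hσ) (k.add_mem (k.mul_mem hr hσ) hτ) hu hp
    refine ⟨⟨hk1, hk2⟩, ?_, ?_, ?_, ?_⟩
    · dsimp only
      rw [hdd, show s * (r * σ + τ) - r * (s * σ) = s * τ by ring]
      exact mul_ne_zero hs0 hτ0
    · rw [Ne, hQ _ hk1, h1]
      exact hs0
    · rw [Ne, hQ _ hk2, h1]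
      exact mul_ne_zero hs0 hσ01.1
    · rw [Ne, hQ _ ⟨k.add_mem hk1.1 hk2.1, k.add_mem hk1.2 hk2.2⟩, hadd, h1, h1,
        show s + s * σ = s * (σ - 1) by linear_combination s * h2]
      exact mul_ne_zero hs0 (sub_ne_zero.2 hσ01.2)
  · rintro ⟨s, σ, r, τ⟩ ⟨⟨hs, hs0⟩, -⟩ ⟨s', σ', r', τ'⟩ - h
    simp only [Prod.mk.injEq] at h
    have e1 := congrArg (det2 · p) h.1
    have e2 := congrArg (det2 · u) h.1
    have e3 := congrArg (det2 · p) h.2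
    have e4 := congrArg (det2 · u) h.2
    simp only [h1, h1'] at e1 e2 e3 e4
    subst e1 e2
    have e3 := mul_left_cancel₀ hs0 e3
    subst e3
    rw [add_left_cancel e4]
  · rintro ⟨w₁, w₂⟩ ⟨⟨hk1, hk2⟩, hd, hQ1, hQ2, hQ12⟩
    dsimp only at *
    have hup0 : det2 u p ≠ 0 := by rw [hup]; exact one_ne_zero
    rw [Ne, hQ _ ⟨k.add_mem hk1.1 hk2.1, k.add_mem hk1.2 hk2.2⟩] at hQ12
    rw [Ne, hQ _ hk1] at hQ1
    rw [Ne, hQ _ hk2] at hQ2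
    obtain ⟨s, hs, r, hr, rfl⟩ := exists_coords h2 k hup0 hu hp hk1
    obtain ⟨s', hs', r', hr', rfl⟩ := exists_coords h2 k hup0 hu hp hk2
    rw [hadd, h1, h1] at hQ12
    rw [h1] at hQ1 hQ2
    rw [hdd] at hd
    refine ⟨(s, s' / s, r, r' - r * (s' / s)), ⟨⟨hs, hQ1⟩, ⟨k.div_mem hs' hs, ?_⟩, hr,
      k.sub_mem hr' (k.mul_mem hr (k.div_mem hs' hs)), ?_⟩, ?_⟩
    · rintro (h | h)
      · exact div_ne_zero hQ2 hQ1 h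
      · have h : s' / s = 1 := h
        rw [div_eq_one_iff_eq hQ1] at h
        exact hQ12 (by linear_combination h + s * h2)
    · intro h
      have h : r' - r * (s' / s) = 0 := h
      field_simp at h
      exact hd (by linear_combination h)
    · simp only [mul_div_cancel₀ _ hQ1, add_sub_cancel]

end PairCounts

theorem six_mul_choose_three (n : ℕ) : 6 * n.choose 3 = n * ((n - 1) * (n - 2)) := by
  have h := Nat.descFactorial_eq_factorial_mul_choose n 3
  rw [show Nat.factorial 3 = 6 from rfl] at h
  rw [← h]
  simp only [Nat.descFactorial]
  ring_nf
  simp [mul_comm]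

/-! ### Forms proportional to a form over the subfield -/

section Subfield

/-- The elements of a finite subfield are the fixed points of its Frobenius map. -/
theorem exists_algebraMap_eq_of_pow_card_eq {K L : Type*} [Field K] [Field L] [Algebra K L]
    [Finite K] {x : L} (hx : x ^ Nat.card K = x) : ∃ y : K, algebraMap K L y = x := by
  classical
  have := Fintype.ofFinite K
  have h1 : 1 < Nat.card K := Finite.one_lt_card
  set g : Polynomial L := Polynomial.X ^ Nat.card K - Polynomial.X with hg
  have hg0 : g ≠ 0 := FiniteField.X_pow_card_sub_X_ne_zero L h1
  have hsub : Finset.univ.image (algebraMap K L) ⊆ g.roots.toFinset := by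
    intro z hz
    obtain ⟨y, -, rfl⟩ := Finset.mem_image.1 hz
    have : y ^ Nat.card K = y := by rw [Nat.card_eq_fintype_card]; exact FiniteField.pow_card y
    rw [Multiset.mem_toFinset, Polynomial.mem_roots hg0]
    simp only [Polynomial.IsRoot.def, hg, Polynomial.eval_sub, Polynomial.eval_pow, Polynomial.eval_X,
      ← map_pow, this, sub_self]
  have hcard : g.roots.toFinset.card ≤ (Finset.univ.image (algebraMap K L)).card := by
    rw [Finset.card_image_of_injective _ (algebraMap K L).injective, Finset.card_univ,
      ← Nat.card_eq_fintype_card]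
    refine (Multiset.toFinset_card_le _).trans ((Polynomial.card_roots' g).trans ?_)
    rw [hg, FiniteField.X_pow_card_sub_X_natDegree_eq L h1]
  have hmem : x ∈ g.roots.toFinset := by
    rw [Multiset.mem_toFinset, Polynomial.mem_roots hg0]
    simp only [Polynomial.IsRoot.def, hg, Polynomial.eval_sub, Polynomial.eval_pow, Polynomial.eval_X,
      hx, sub_self]
  rw [← Finset.eq_of_subset_of_card_le hsub hcard] at hmem
  obtain ⟨y, -, hy⟩ := Finset.mem_image.1 hmem
  exact ⟨y, hy⟩

variable {F : Type*} [Field F] {a b f : F}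

theorem DefinedOver.exists_coeff {k : Subfield F} (h : DefinedOver k a b f) :
    ∃ d, ∃ A ∈ k, ∃ B ∈ k, ∃ C ∈ k, a = d * A ∧ b = d * B ∧ f = d * C := by
  obtain ⟨d, hd⟩ := h
  obtain ⟨A, hA, e1⟩ := hd (1, 0) ⟨k.one_mem, k.zero_mem⟩
  obtain ⟨B, hB, e2⟩ := hd (0, 1) ⟨k.zero_mem, k.one_mem⟩
  obtain ⟨C, hC, e3⟩ := hd (1, 1) ⟨k.one_mem, k.one_mem⟩
  simp only [binForm] at e1 e2 e3
  refine ⟨d, A, hA, B, hB, C - A - B, k.sub_mem (k.sub_mem hC hA) hB, ?_, ?_, ?_⟩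
  · linear_combination e1
  · linear_combination e2
  · linear_combination e3 - e1 - e2

/-- A form over the subfield with one rational zero has a second one. -/
theorem not_definedOver_of_unique_zero (h2 : (2 : F) = 0) (hf : f ≠ 0) {k : Subfield F}
    {p : F × F} (hp : p ∈ subPlane k) (hp0 : p ≠ 0) (hQp : binForm a b f p = 0)
    (hQ : ∀ w ∈ subPlane k, binForm a b f w = 0 → det2 w p = 0) : ¬ DefinedOver k a b f := by
  intro h
  obtain ⟨d, A, hA, B, hB, C, hC, rfl, rfl, rfl⟩ := h.exists_coeff
  have hd : d ≠ 0 := left_ne_zero_of_mul hf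
  obtain ⟨u, hu, hup⟩ : ∃ u ∈ subPlane k, det2 u p ≠ 0 := by
    by_cases hx : p.1 = 0
    · have hy : p.2 ≠ 0 := fun hy => hp0 (Prod.ext hx hy)
      exact ⟨(1, 0), ⟨k.one_mem, k.zero_mem⟩, by simp [det2, hy]⟩
    · exact ⟨(0, 1), ⟨k.zero_mem, k.one_mem⟩, by simp [det2, hx]⟩
  have hQu : binForm A B C u ∈ k :=
    k.add_mem (k.add_mem (k.mul_mem hA (k.pow_mem hu.1 2))
      (k.mul_mem hC (k.mul_mem hu.1 hu.2))) (k.mul_mem hB (k.pow_mem hu.2 2))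
  have hdk : det2 u p ∈ k := k.add_mem (k.mul_mem hu.1 hp.2) (k.mul_mem hu.2 hp.1)
  have hC0 : C ≠ 0 := right_ne_zero_of_mul hf
  -- Since `Q(p) = 0`, the value `Q(u + l p)` is affine in `l`; this is its root, and it lies in
  -- `k`.
  set l := binForm A B C u / (C * det2 u p) with hl
  have hlk : l ∈ k := k.div_mem hQu (k.mul_mem hC hdk)
  have e : binForm (d * A) (d * B) (d * C) ((1 : F) • u + l • p) = 0 := by
    have hlm : l * (C * det2 u p) = binForm A B C u := div_mul_cancel₀ _ (mul_ne_zero hC0 hup)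
    rw [binForm_smul_add_smul h2, hQp,
      show binForm (d * A) (d * B) (d * C) u = d * binForm A B C u by simp only [binForm]; ring]
    linear_combination d * hlm + d * binForm A B C u * h2
  have := hQ _ (smul_add_smul_mem_subPlane k.one_mem hlk hu hp) e
  refine hup ?_
  rw [← this]
  simp only [det2, Prod.smul_fst, Prod.smul_snd, Prod.fst_add, Prod.snd_add, smul_eq_mul]
  linear_combination -(l * p.1 * p.2) * h2

variable [Finite F]

theorem mem_of_pow_card_eq {k : Subfield F} {x : F} (hx : x ^ Nat.card k = x) : x ∈ k := by
  obtain ⟨y, rfl⟩ := exists_algebraMap_eq_of_pow_card_eq (K := k) hx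
  exact y.2

/-- A form over the subfield is carried to its power by the Frobenius map. -/
theorem quadratic_pow_card {K L : Type*} [Field K] [Field L] [Algebra K L] [Finite K]
    (A B C : K) (x y : L) :
    (algebraMap K L A * x ^ 2 + algebraMap K L C * (x * y) + algebraMap K L B * y ^ 2) ^ Nat.card K
      = algebraMap K L A * (x ^ Nat.card K) ^ 2
        + algebraMap K L C * (x ^ Nat.card K * y ^ Nat.card K)
        + algebraMap K L B * (y ^ Nat.card K) ^ 2 := by
  have := Fintype.ofFinite K
  have h := fun z : L => congrFun (FiniteField.coe_frobeniusAlgHom K L) z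
  simp only [← Nat.card_eq_fintype_card] at h
  simp only [← h, map_add, map_mul, map_pow, AlgHom.commutes]

/-- A binary quadratic form over a finite field has a zero over the quadratic extension. -/
theorem exists_zero_of_mem {k : Subfield F} (hF : Nat.card F = Nat.card k ^ 2)
    {A B C : F} (hA : A ∈ k) (hB : B ∈ k) (hC : C ∈ k) :
    ∃ w : F × F, w ≠ 0 ∧ binForm A B C w = 0 := by
  by_cases hA0 : A = 0
  · exact ⟨(1, 0), by simp, by simp [binForm, hA0]⟩
  set E := AlgebraicClosure F
  let φ := algebraMap F E
  have hφA : φ A ≠ 0 := by simpa using hA0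
  obtain ⟨r, hr⟩ : ∃ r : E, φ A * r ^ 2 + φ C * (r * 1) + φ B * 1 ^ 2 = 0 := by
    obtain ⟨r, hr⟩ := IsAlgClosed.exists_root
      (Polynomial.C (φ A) * Polynomial.X ^ 2 + Polynomial.C (φ C) * Polynomial.X
        + Polynomial.C (φ B)) (by rw [Polynomial.degree_quadratic hφA]; decide)
    refine ⟨r, ?_⟩
    simpa [Polynomial.IsRoot] using hr
  have hpow : ∀ r : E, φ A * r ^ 2 + φ C * (r * 1) + φ B * 1 ^ 2 = 0 →
      φ A * (r ^ Nat.card k) ^ 2 + φ C * (r ^ Nat.card k * 1) + φ B * 1 ^ 2 = 0 := by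
    intro r hr
    have h := quadratic_pow_card (⟨A, hA⟩ : k) ⟨B, hB⟩ ⟨C, hC⟩ r (1 : E)
    have e : ∀ z : k, algebraMap k E z = φ z := fun z => rfl
    simp only [e, hr] at h
    rw [zero_pow Nat.card_pos.ne', one_pow] at h
    exact h.symm
  have hr1 := hpow r hr
  have hr2 := hpow _ hr1
  set r1 := r ^ Nat.card k with hr1d
  set r2 := r1 ^ Nat.card k with hr2d
  -- `r`, `r^q` and `r^(q²)` are roots of one quadratic. If `r^q ≠ r`, then `r^(q²) ≠ r^q` by
  -- injectivity of Frobenius, so the sum of the roots forces `r^(q²) = r`, whence `r` is in `F`.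
  have hfix : r2 = r := by
    by_cases h1 : r1 = r
    · rw [hr2d, h1, ← hr1d, h1]
    · have hs : φ A * (r + r1) + φ C = 0 := by
        refine (mul_eq_zero.1 ?_).resolve_left (sub_ne_zero.2 h1)
        linear_combination hr1 - hr
      by_cases h2 : r2 = r1
      · exfalso
        have := Fintype.ofFinite k
        have h := fun z : E => congrFun (FiniteField.coe_frobeniusAlgHom k E) z
        simp only [← Nat.card_eq_fintype_card] at h
        rw [hr2d] at h2
        have h2' : r1 ^ Nat.card k = r ^ Nat.card k := h2
        rw [← h, ← h] at h2'
        exact h1 ((FiniteField.frobeniusAlgHom k E).toRingHom.injective h2')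
      · have hs2 : φ A * (r1 + r2) + φ C = 0 := by
          refine (mul_eq_zero.1 ?_).resolve_left (sub_ne_zero.2 h2)
          linear_combination hr2 - hr1
        exact mul_left_cancel₀ hφA (by linear_combination hs2 - hs)
  rw [hr2d, hr1d, ← pow_mul, ← sq, ← hF] at hfix
  obtain ⟨y, hy⟩ := exists_algebraMap_eq_of_pow_card_eq (K := F) hfix
  refine ⟨(y, 1), by simp, ?_⟩
  apply φ.injective
  rw [map_zero, ← hr, ← hy]
  simp [binForm, φ]

theorem not_definedOver_of_anisotropic {k : Subfield F} (hF : Nat.card F = Nat.card k ^ 2)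
    (hQ : ∀ w : F × F, w ≠ 0 → binForm a b f w ≠ 0) : ¬ DefinedOver k a b f := by
  intro h
  obtain ⟨d, A, hA, B, hB, C, hC, rfl, rfl, rfl⟩ := h.exists_coeff
  obtain ⟨w, hw, hw0⟩ := exists_zero_of_mem hF hA hB hC
  refine hQ w hw ?_
  simp only [binForm] at *
  linear_combination d * hw0

theorem DefinedOver.binForm_frobenius {k : Subfield F} (h : DefinedOver k a b f) (hf : f ≠ 0)
    {x y : F} (hw : binForm a b f (x, y) = 0) :
    binForm a b f (x ^ Nat.card k, y ^ Nat.card k) = 0 := by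
  obtain ⟨d, A, hA, B, hB, C, hC, rfl, rfl, rfl⟩ := h.exists_coeff
  have hd : d ≠ 0 := left_ne_zero_of_mul hf
  have h := quadratic_pow_card (⟨A, hA⟩ : k) ⟨B, hB⟩ ⟨C, hC⟩ x y
  have e : ∀ z : k, algebraMap k F z = z := fun z => rfl
  simp only [e] at h
  simp only [binForm] at *
  have h0 : A * x ^ 2 + C * (x * y) + B * y ^ 2 = 0 :=
    mul_left_cancel₀ hd (by linear_combination hw)
  rw [h0, zero_pow Nat.card_pos.ne'] at h
  linear_combination -d * h

end Subfield

/-! ### Projective conics in affine coordinates -/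

section Projective

variable {F : Type*} [Field F]

theorem infinityVec_ne_zero {w : F × F} (hw : w ≠ 0) : ![w.1, w.2, 0] ≠ 0 := fun h =>
  hw (Prod.ext (congrFun h 0) (congrFun h 1))

/-- The point at infinity in a given direction. -/
def infinityPoint (w : F × F) (hw : w ≠ 0) : PG2 F :=
  Projectivization.mk F ![w.1, w.2, 0] (infinityVec_ne_zero hw)

theorem infinityPoint_mem_lineAtInfinity (w : F × F) (hw : w ≠ 0) :
    infinityPoint w hw ∈ lineAtInfinity F := by
  rw [infinityPoint, mk_mem_lineAtInfinity]; rfl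

theorem exists_infinityPoint {P : PG2 F} (hP : P ∈ lineAtInfinity F) :
    ∃ (w : F × F) (hw : w ≠ 0), P = infinityPoint w hw := by
  have hP : P.rep 2 = 0 := hP
  have hrep : P.rep = ![P.rep 0, P.rep 1, 0] := by
    ext i; fin_cases i <;> simp [hP]
  have hw : (P.rep 0, P.rep 1) ≠ (0 : F × F) := by
    intro h
    have h0 : P.rep 0 = 0 := congrArg Prod.fst h
    have h1 : P.rep 1 = 0 := congrArg Prod.snd h
    exact P.rep_nonzero (by ext i; fin_cases i <;> simp [hP, h0, h1])
  refine ⟨(P.rep 0, P.rep 1), hw, ?_⟩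
  conv_lhs => rw [← P.mk_rep]
  unfold infinityPoint
  congr 1

theorem infinityPoint_mem_quadZeros {a b c d e f : F} {w : F × F} (hw : w ≠ 0) :
    infinityPoint w hw ∈ quadZeros a b c d e f ↔ binForm a b f w = 0 := by
  rw [infinityPoint, mk_mem_quadZeros]
  simp [binForm, add_right_comm]

theorem infinityPoint_eq_iff {w w' : F × F} (hw : w ≠ 0) (hw' : w' ≠ 0) :
    infinityPoint w hw = infinityPoint w' hw' ↔ ∃ s : F, w = s • w' := by
  rw [infinityPoint, infinityPoint, Projectivization.mk_eq_mk_iff']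
  constructor
  · rintro ⟨s, hs⟩
    exact ⟨s, Prod.ext (congrFun hs 0).symm (congrFun hs 1).symm⟩
  · rintro ⟨s, rfl⟩
    exact ⟨s, by ext i; fin_cases i <;> simp⟩

theorem infinityPoint_eq_iff_det2 (h2 : (2 : F) = 0) {w w' : F × F} (hw : w ≠ 0) (hw' : w' ≠ 0) :
    infinityPoint w hw = infinityPoint w' hw' ↔ det2 w w' = 0 := by
  rw [infinityPoint_eq_iff]
  constructor
  · rintro ⟨s, rfl⟩
    simp only [det2, Prod.smul_fst, Prod.smul_snd, smul_eq_mul]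
    linear_combination (s * w'.1 * w'.2) * h2
  · intro h
    refine exists_smul_of_det2_eq_zero h2 hw' ?_
    rw [← h]; simp only [det2]; ring

theorem infinityPoint_mem_derivationSet {k : Subfield F} {w : F × F} (hw : w ≠ 0)
    (hk : w ∈ subPlane k) : infinityPoint w hw ∈ derivationSet k :=
  ⟨w.1, w.2, infinityVec_ne_zero hw, hk.1, hk.2, rfl⟩

theorem exists_of_mem_derivationSet {k : Subfield F} {P : PG2 F} (hP : P ∈ derivationSet k) :
    ∃ (w : F × F) (hw : w ≠ 0), w ∈ subPlane k ∧ P = infinityPoint w hw := by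
  obtain ⟨x, y, h, hx, hy, rfl⟩ := hP
  refine ⟨(x, y), ?_, ⟨hx, hy⟩, rfl⟩
  rintro h'
  have h0 : x = 0 := congrArg Prod.fst h'
  have h1 : y = 0 := congrArg Prod.snd h'
  exact h (by ext i; fin_cases i <;> simp [h0, h1])

/-- The linear part `e x + d y` equals `f * det2 p p₀` for `p₀ = (d / f, e / f)`, so it is absorbed
by completing the form at that center. -/
theorem affinePart_quadZeros (h2 : (2 : F) = 0) {a b c d e f : F} (hf : f ≠ 0) :
    affinePart (quadZeros a b c d e f) = centralConic a b f (d / f, e / f)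
      (binForm a b f (d / f, e / f) + c) := by
  ext p
  change affinePoint p ∈ quadZeros a b c d e f ↔ binForm a b f (p + (d / f, e / f)) = _
  rw [affinePoint, mk_mem_quadZeros, binForm_add, h2]
  have hd : f * det2 p (d / f, e / f) = e * p.1 + d * p.2 := by
    simp only [det2]; field_simp
  rw [hd]
  simp only [binForm, Matrix.cons_val_zero, Matrix.cons_val_one, Matrix.cons_val_two,
    Matrix.head_cons, Matrix.tail_cons]
  constructor
  · intro h; linear_combination h - c * h2
  · intro h; linear_combination h + c * h2

theorem exists_linear_factors {E : Type*} [Field E] [IsAlgClosed E] (a b f : E) :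
    ∃ α β γ δ : E, a = α * γ ∧ b = β * δ ∧ f = α * δ + β * γ := by
  by_cases ha : a = 0
  · exact ⟨0, 1, f, b, by simp [ha], by simp, by simp⟩
  obtain ⟨r, hr⟩ := IsAlgClosed.exists_root
    (Polynomial.C a * Polynomial.X ^ 2 + Polynomial.C f * Polynomial.X + Polynomial.C b)
    (by rw [Polynomial.degree_quadratic ha]; decide)
  have hr : a * r ^ 2 + f * r + b = 0 := by simpa [Polynomial.IsRoot] using hr
  exact ⟨1, -r, a, a * r + f, by ring, by linear_combination hr, by ring⟩

/-- The center of an irreducible conic does not lie on it. -/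
theorem binForm_center_ne_zero (h2 : (2 : F) = 0) {a b c d e f : F} (hf : f ≠ 0)
    (hirr : Irreducible ((quadForm a b c d e f).map (algebraMap F (AlgebraicClosure F)))) :
    binForm a b f (d / f, e / f) + c ≠ 0 := by
  intro h0
  let φ := algebraMap F (AlgebraicClosure F)
  -- If the constant vanished, the conic would be a binary form in `X + x Z` and `Y + y Z`, which
  -- splits over the algebraic closure into two factors vanishing at the origin.
  obtain ⟨α, β, γ, δ, hα, hβ, hγ⟩ := exists_linear_factors (φ a) (φ b) (φ f)
  set x := φ (d / f) with hx
  set y := φ (e / f) with hy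
  have hd : φ d = φ f * x := by rw [hx, ← map_mul, mul_div_cancel₀ _ hf]
  have he : φ e = φ f * y := by rw [hy, ← map_mul, mul_div_cancel₀ _ hf]
  have hc : φ c = φ a * x ^ 2 + φ f * (x * y) + φ b * y ^ 2 := by
    rw [hx, hy]
    simp only [← map_mul, ← map_pow, ← map_add]
    congr 1
    simp only [binForm] at h0
    linear_combination -h0 + c * h2
  have h2E : (2 : AlgebraicClosure F) = 0 := by
    rw [← map_ofNat φ 2, h2, map_zero]
  have h2P : (2 : MvPolynomial (Fin 3) (AlgebraicClosure F)) = 0 := by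
    rw [← map_ofNat MvPolynomial.C 2, h2E, map_zero]
  have hfac : (quadForm a b c d e f).map φ
      = (.C α * (.X 0 + .C x * .X 2) + .C β * (.X 1 + .C y * .X 2))
        * (.C γ * (.X 0 + .C x * .X 2) + .C δ * (.X 1 + .C y * .X 2)) := by
    simp only [quadForm, map_add, map_mul, map_pow, MvPolynomial.map_C, MvPolynomial.map_X]
    rw [hd, he, hc, hα, hβ, hγ]
    simp only [map_add, map_mul, map_pow]
    linear_combination (-(MvPolynomial.C α * MvPolynomial.C γ * MvPolynomial.C x
        * MvPolynomial.X 0 * MvPolynomial.X 2)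
      - MvPolynomial.C β * MvPolynomial.C δ * MvPolynomial.C y
        * MvPolynomial.X 1 * MvPolynomial.X 2) * h2P
  have hunit : ∀ s t : AlgebraicClosure F,
      ¬ IsUnit (.C s * (.X 0 + .C x * .X 2) + .C t * (.X 1 + .C y * .X 2) :
        MvPolynomial (Fin 3) (AlgebraicClosure F)) := by
    intro s t hu
    have := hu.map (MvPolynomial.eval (0 : Fin 3 → AlgebraicClosure F))
    simp at this
  rcases hirr.isUnit_or_isUnit hfac with hu | hu
  · exact hunit _ _ hu
  · exact hunit _ _ hu

variable [Finite F]

/-- In characteristic two, a conic that is not tangent to the line at infinity has a nonzero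
mixed coefficient. -/
theorem mixed_coeff_ne_zero (h2 : (2 : F) = 0) {a b c d e f : F}
    (hK : quadZeros a b c d e f ∩ lineAtInfinity F = ∅ ∨
      (quadZeros a b c d e f ∩ lineAtInfinity F).ncard = 2) : f ≠ 0 := by
  rintro rfl
  have hmem : ∀ (w : F × F) (hw : w ≠ 0), binForm a b 0 w = 0 →
      infinityPoint w hw ∈ quadZeros a b c d e 0 ∩ lineAtInfinity F := fun w hw h =>
    ⟨(infinityPoint_mem_quadZeros hw).2 h, infinityPoint_mem_lineAtInfinity w hw⟩
  -- With `f = 0` the form at infinity is the square of a linear form. It therefore vanishes at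
  -- exactly one point of the line at infinity, or at all of them.
  obtain ⟨α, rfl⟩ := Finite.surjective_of_injective (sq_injective h2) a
  obtain ⟨β, rfl⟩ := Finite.surjective_of_injective (sq_injective h2) b
  have hsq : ∀ w : F × F, binForm (α ^ 2) (β ^ 2) 0 w = (α * w.1 + β * w.2) ^ 2 := by
    intro w
    simp only [binForm]
    linear_combination -(α * w.1 * (β * w.2)) * h2
  have hlin : ∀ w : F × F, binForm (α ^ 2) (β ^ 2) 0 w = 0 ↔ α * w.1 + β * w.2 = 0 := by
    intro w; rw [hsq]; exact pow_eq_zero_iff two_ne_zero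
  have h10 : ((1, 0) : F × F) ≠ 0 := by simp
  have h01 : ((0, 1) : F × F) ≠ 0 := by simp
  have h11 : ((1, 1) : F × F) ≠ 0 := by simp
  rcases hK with hK | hK
  · by_cases hw : (β, α) = (0 : F × F)
    · have hα : α = 0 := congrArg Prod.snd hw
      have := hmem (1, 0) h10 ((hlin _).2 (by simp [hα]))
      simp only [hK, Set.mem_empty_iff_false] at this
    · have := hmem (β, α) hw ((hlin _).2 (by linear_combination α * β * h2))
      simp only [hK, Set.mem_empty_iff_false] at this
  · obtain ⟨P, P', hne, hPP⟩ := Set.ncard_eq_two.1 hK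
    have hP : P ∈ quadZeros (α ^ 2) (β ^ 2) c d e 0 ∩ lineAtInfinity F := by rw [hPP]; simp
    have hP' : P' ∈ quadZeros (α ^ 2) (β ^ 2) c d e 0 ∩ lineAtInfinity F := by rw [hPP]; simp
    obtain ⟨w, hw, rfl⟩ := exists_infinityPoint hP.2
    obtain ⟨w', hw', rfl⟩ := exists_infinityPoint hP'.2
    have e1 := (hlin _).1 ((infinityPoint_mem_quadZeros hw).1 hP.1)
    have e2 := (hlin _).1 ((infinityPoint_mem_quadZeros hw').1 hP'.1)
    rw [Ne, infinityPoint_eq_iff_det2 h2] at hne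
    have hα : α = 0 := by
      refine mul_right_cancel₀ hne ?_
      simp only [det2]
      linear_combination w'.2 * e1 + w.2 * e2 - β * w.2 * w'.2 * h2
    have hβ : β = 0 := by
      refine mul_right_cancel₀ hne ?_
      simp only [det2]
      linear_combination w'.1 * e1 + w.1 * e2 - α * w.1 * w'.1 * h2
    have hall : ∀ w : F × F, binForm (α ^ 2) (β ^ 2) 0 w = 0 := by
      intro w; rw [hlin, hα, hβ]; ring
    have : Finite (PG2 F) := Quotient.finite _
    have h3 : 2 < (quadZeros (α ^ 2) (β ^ 2) c d e 0 ∩ lineAtInfinity F).ncard := by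
      rw [Set.two_lt_ncard_iff (Set.toFinite _)]
      refine ⟨_, _, _, hmem (1, 0) h10 (hall _), hmem (0, 1) h01 (hall _),
        hmem (1, 1) h11 (hall _), ?_, ?_, ?_⟩ <;>
      · rw [Ne, infinityPoint_eq_iff_det2 h2]
        simp [det2]
    exact h3.ne' hK

/-- A point fixed by Frobenius has its coordinate ratio fixed by the `q`-th power map, hence in `k`.
-/
theorem mem_derivationSet_of_frobenius (h2 : (2 : F) = 0) {k : Subfield F} {x y : F}
    (hw : (x, y) ≠ (0 : F × F))
    (h : det2 (x, y) (x ^ Nat.card k, y ^ Nat.card k) = 0) :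
    infinityPoint (x, y) hw ∈ derivationSet k := by
  have h : x * y ^ Nat.card k + y * x ^ Nat.card k = 0 := h
  by_cases hx : x = 0
  · have h01 : ((0, 1) : F × F) ≠ 0 := by simp
    rw [show infinityPoint (x, y) hw = infinityPoint (0, 1) h01 from
      (infinityPoint_eq_iff hw h01).2 ⟨y, by simp [hx]⟩]
    exact infinityPoint_mem_derivationSet h01 ⟨k.zero_mem, k.one_mem⟩
  · have h1 : ((1, y / x) : F × F) ≠ 0 := by simp
    rw [show infinityPoint (x, y) hw = infinityPoint (1, y / x) h1 from
      (infinityPoint_eq_iff hw h1).2 ⟨x, by simp [mul_div_cancel₀ _ hx]⟩]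
    refine infinityPoint_mem_derivationSet h1 ⟨k.one_mem, mem_of_pow_card_eq ?_⟩
    rw [div_pow, div_eq_div_iff (pow_ne_zero _ hx) hx]
    linear_combination h - y * x ^ Nat.card k * h2

/-- If the form were proportional to one over `k`, Frobenius would send `P` to a zero at infinity:
either `P` itself, which puts `P` in `D`, or `P'`, which makes the two conjugate. -/
theorem not_definedOver_of_not_conjugate (h2 : (2 : F) = 0) {k : Subfield F}
    {a b c d e f : F} (hf : f ≠ 0) {P P' : PG2 F}
    (hK : quadZeros a b c d e f ∩ lineAtInfinity F = {P, P'}) (hP : P ∉ derivationSet k)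
    (hconj : ¬ Conjugate (Nat.card k) P P') : ¬ DefinedOver k a b f := by
  intro hdef
  have hPK : P ∈ quadZeros a b c d e f ∩ lineAtInfinity F := by rw [hK]; simp
  obtain ⟨⟨x, y⟩, hw, rfl⟩ := exists_infinityPoint hPK.2
  have hq : Nat.card k ≠ 0 := Nat.card_pos.ne'
  have hw' : (x ^ Nat.card k, y ^ Nat.card k) ≠ (0 : F × F) := by
    intro h
    exact hw (Prod.ext (eq_zero_of_pow_eq_zero (congrArg Prod.fst h))
      (eq_zero_of_pow_eq_zero (congrArg Prod.snd h)))
  have hz := hdef.binForm_frobenius hf ((infinityPoint_mem_quadZeros hw).1 hPK.1)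
  have hmem : infinityPoint _ hw' ∈ quadZeros a b c d e f ∩ lineAtInfinity F :=
    ⟨(infinityPoint_mem_quadZeros hw').2 hz, infinityPoint_mem_lineAtInfinity _ hw'⟩
  rw [hK] at hmem
  rcases hmem with h | h
  · refine hP (mem_derivationSet_of_frobenius h2 hw ?_)
    rw [← infinityPoint_eq_iff_det2 h2 hw hw', h]
  · refine hconj ?_
    rw [← show infinityPoint _ hw' = P' from h]
    have hvec : (fun i => (![x, y, 0] : Fin 3 → F) i ^ Nat.card k)
        = ![x ^ Nat.card k, y ^ Nat.card k, 0] := by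
      ext i; fin_cases i <;> simp [hq]
    refine ⟨![x, y, 0], infinityVec_ne_zero hw, ?_, rfl, ?_⟩
    · rw [hvec]; exact infinityVec_ne_zero hw'
    · unfold infinityPoint
      congr 1
      exact hvec.symm

end Projective

/-! ### Final counts and bounds -/

theorem two_eq_zero_of_even_card {F : Type*} [Field F] [Finite F] {q : ℕ}
    (hF : Nat.card F = q ^ 2) (hq : Even q) : (2 : F) = 0 := by
  have := Fintype.ofFinite F
  have h : ringChar F = 2 := by
    rw [FiniteField.even_card_iff_char_two, ← Nat.card_eq_fintype_card, hF, ← Nat.even_iff]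
    exact hq.pow_of_ne_zero two_ne_zero
  have := ringChar.Nat.cast_ringChar (R := F)
  rw [h] at this
  exact_mod_cast this

theorem hallLines_bound {F : Type*} [Field F] [Finite F] (h2 : (2 : F) = 0) {a b f c : F}
    {p₀ : F × F} (hf : f ≠ 0) (hc : c ≠ 0) {k : Subfield F} {n : ℕ} (hn : 2 ≤ n)
    (h : ∀ L ∈ newLines k, (L ∩ centralConic a b f p₀ c).ncard ≤ n) :
    ∀ L ∈ hallLines k, (L ∩ centralConic a b f p₀ c).ncard ≤ n := by
  rintro L (hL | hL)
  · exact (ncard_oldLines_inter_le h2 hf hc hL).trans hn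
  · exact h L hL

/-- The anisotropic case. -/
theorem collinear_of_anisotropic {F : Type*} [Field F] [Finite F] (h2 : (2 : F) = 0) {a b f c : F}
    {p₀ : F × F} (hf : f ≠ 0) (hc : c ≠ 0) {k : Subfield F} (hN : ¬ DefinedOver k a b f)
    (hQ : ∀ w ∈ subPlane k, w ≠ 0 → binForm a b f w ≠ 0) :
    (∀ L ∈ hallLines k, (L ∩ centralConic a b f p₀ c).ncard ≤ 4) ∧
      (collinearTriples k (centralConic a b f p₀ c)).ncard = (Nat.card k + 1).choose 3 := by
  refine ⟨hallLines_bound h2 hf hc (by norm_num)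
    fun L hL => ncard_newLines_inter_le_four h2 hf hc hN hL, ?_⟩
  have hcount := ncard_collinearTriples (p₀ := p₀) (a := a) (b := b) h2 hf hc k
  rw [ncard_anisotropicPairs_of_anisotropic h2 k hQ] at hcount
  have h6 := six_mul_choose_three (Nat.card k + 1)
  have hk : 1 < Nat.card k := Finite.one_lt_card
  -- Writing `q = m + 1` turns the truncated subtractions into products, after which the factor `q -
  -- 1 = m` cancels.
  obtain ⟨m, hm⟩ : ∃ m, Nat.card k = m + 1 := ⟨Nat.card k - 1, by omega⟩
  rw [hm] at hcount h6 hk ⊢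
  rw [show (m + 1) ^ 2 - 1 = m * (m + 2) from Nat.sub_eq_of_eq_add (by ring),
    show (m + 1) ^ 2 - (m + 1) = (m + 1) * m from Nat.sub_eq_of_eq_add (by ring),
    Nat.add_sub_cancel, mul_assoc] at hcount
  have h := Nat.eq_of_mul_eq_mul_left (by omega) hcount
  rw [show m + 1 + 1 - 1 = m + 1 by omega, show m + 1 + 1 - 2 = m by omega] at h6
  exact Nat.eq_of_mul_eq_mul_left (by norm_num : 0 < 6) (h.trans h6.symm)

/-- The case of a single isotropic direction. -/
theorem collinear_of_isotropic {F : Type*} [Field F] [Finite F] (h2 : (2 : F) = 0) {a b f c : F}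
    {p₀ : F × F} (hf : f ≠ 0) (hc : c ≠ 0) {k : Subfield F} {p : F × F}
    (hp : p ∈ subPlane k) (hp0 : p ≠ 0)
    (hQ : ∀ w ∈ subPlane k, binForm a b f w = 0 ↔ det2 w p = 0) :
    (∀ L ∈ hallLines k, (L ∩ centralConic a b f p₀ c).ncard ≤ 3) ∧
      (collinearTriples k (centralConic a b f p₀ c)).ncard = (Nat.card k).choose 3 := by
  have hQp : binForm a b f p = 0 := (hQ p hp).2 (by
    simp only [det2]; linear_combination p.1 * p.2 * h2)
  refine ⟨hallLines_bound h2 hf hc (by norm_num) fun L hL => ncard_newLines_inter_le_three h2 hf hc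
    (not_definedOver_of_unique_zero h2 hf hp hp0 hQp fun w hw => (hQ w hw).1) hp hp0 hQp hL, ?_⟩
  have hcount := ncard_collinearTriples (p₀ := p₀) (a := a) (b := b) h2 hf hc k
  rw [ncard_anisotropicPairs_of_isotropic h2 k hp hp0 hQ] at hcount
  have hk : 1 < Nat.card k := Finite.one_lt_card
  have h := Nat.eq_of_mul_eq_mul_left (by omega) hcount
  refine Nat.eq_of_mul_eq_mul_left (by norm_num : 0 < 6) (h.trans ?_)
  rw [six_mul_choose_three]
  ring

end HallPlane

theorem mainTheorem7 {F : Type*} [Field F] [Finite F] (k : Subfield F) (q : ℕ)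
    (hk : Nat.card k = q) (hF : Nat.card F = q ^ 2) (hq : Even q)
    (K : Set (HallPlane.PG2 F)) :
    ((HallPlane.IsEllipse K ∨
        (HallPlane.IsHyperbola K ∧ ∃ P P' : HallPlane.PG2 F,
          P ≠ P' ∧ K ∩ HallPlane.lineAtInfinity F = {P, P'} ∧
          P ∉ HallPlane.derivationSet k ∧ P' ∉ HallPlane.derivationSet k ∧
          ¬ HallPlane.Conjugate q P P')) →
      (∀ L ∈ HallPlane.hallLines k, (L ∩ HallPlane.affinePart K).ncard ≤ 4) ∧
      (HallPlane.collinearTriples k (HallPlane.affinePart K)).ncard = (q + 1).choose 3) ∧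
    ((HallPlane.IsHyperbola K ∧ (K ∩ HallPlane.derivationSet k).ncard = 1) →
      (∀ L ∈ HallPlane.hallLines k, (L ∩ HallPlane.affinePart K).ncard ≤ 3) ∧
      (HallPlane.collinearTriples k (HallPlane.affinePart K)).ncard = q.choose 3) := by
  open HallPlane in
  have h2 : (2 : F) = 0 := two_eq_zero_of_even_card hF hq
  subst hk
  constructor
  · rintro (⟨⟨a, b, c, d, e, f, hirr, rfl⟩, hK⟩ |
      ⟨⟨⟨a, b, c, d, e, f, hirr, rfl⟩, hK2⟩, P, P', hne, hK, hP, hP', hconj⟩)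
    · have hf := mixed_coeff_ne_zero h2 (Or.inl hK)
      have hQ : ∀ w : F × F, w ≠ 0 → binForm a b f w ≠ 0 := by
        intro w hw h
        have : infinityPoint w hw ∈ quadZeros a b c d e f ∩ lineAtInfinity F :=
          ⟨(infinityPoint_mem_quadZeros hw).2 h, infinityPoint_mem_lineAtInfinity w hw⟩
        rw [hK] at this
        exact this
      rw [affinePart_quadZeros h2 hf]
      exact collinear_of_anisotropic h2 hf (binForm_center_ne_zero h2 hf hirr)
        (not_definedOver_of_anisotropic hF hQ) fun w _ => hQ w
    · have hf := mixed_coeff_ne_zero h2 (Or.inr hK2)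
      rw [affinePart_quadZeros h2 hf]
      refine collinear_of_anisotropic h2 hf (binForm_center_ne_zero h2 hf hirr)
        (not_definedOver_of_not_conjugate h2 hf hK hP hconj) fun w hwk hw h => ?_
      have hmem : infinityPoint w hw ∈ quadZeros a b c d e f ∩ lineAtInfinity F :=
        ⟨(infinityPoint_mem_quadZeros hw).2 h, infinityPoint_mem_lineAtInfinity w hw⟩
      have hD := infinityPoint_mem_derivationSet hw hwk
      rw [hK] at hmem
      rcases hmem with h | h
      · exact hP (h ▸ hD)
      · exact hP' ((show infinityPoint w hw = P' from h) ▸ hD)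
  · rintro ⟨⟨⟨a, b, c, d, e, f, hirr, rfl⟩, hK2⟩, hD⟩
    have hf := mixed_coeff_ne_zero h2 (Or.inr hK2)
    rw [affinePart_quadZeros h2 hf]
    obtain ⟨P, hP⟩ := Set.ncard_eq_one.1 hD
    have hPm : P ∈ quadZeros a b c d e f ∩ derivationSet k := by rw [hP]; simp
    obtain ⟨p, hp0, hp, rfl⟩ := exists_of_mem_derivationSet hPm.2
    refine collinear_of_isotropic h2 hf (binForm_center_ne_zero h2 hf hirr) hp hp0 ?_
    -- A rational zero of the form is a point of the conic in `D`, of which there is only one,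
    -- namely the direction `p`.
    intro w hwk
    by_cases hw : w = 0
    · simp [hw, binForm, det2]
    rw [← infinityPoint_eq_iff_det2 h2 hw hp0,
      ← infinityPoint_mem_quadZeros (c := c) (d := d) (e := e) hw]
    constructor
    · intro h
      have : infinityPoint w hw ∈ quadZeros a b c d e f ∩ derivationSet k :=
        ⟨h, infinityPoint_mem_derivationSet hw hwk⟩
      rwa [hP] at this
    · intro h
      rw [h]
      exact hPm.1
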